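/- Let $\mathsf k$ be a field of characteristic zero, let $R=\mathsf k[x,y]$ act on $\mathsf k[X,Y]$ by differentiation ($x$ acts as $\partial/\partial X$, $y$ as $\partial/\partial Y$; this action is written $f\circ F$), and for a form $F\in\mathsf k[X,Y]$ put $\operatorname{Ann}F=\{f\in R: f\circ F=0\}$. For a linear form $\ell=ax+by$ and an Artinian quotient $A=R/I$, the Jordan type $P_{\ell,A}$ is the partition of $\dim_{\mathsf k}A$ given by the sizes of the Jordan blocks of multiplication by $\ell$ on $A$. The diagonal lengths of a partition $p_0\ge p_1\ge\cdots$ are the numbers $t_m=\#\{(r,c): r,c\ge 0,\ r+c=m,\ c<p_r\}$, $m\ge 0$. Let $d,k\ge 1$ and let $T=(1,2,\ldots,d-1,d^k,d-1,\ldots,2,1)$, where $d$ occurs $k$ times. Let $P=(p_0\ge p_1\ge\cdots)$ and $Q=(q_0\ge q_1\ge\cdots)$ be partitions with diagonal lengths $T$ that are complete intersection Jordan types: $P=P_{\ell,A}$ and $Q=P_{\ell',A'}$, where $A=R/\operatorname{Ann}F$ and $A'=R/\operatorname{Ann}G$ are graded complete intersections ($F,G$ forms in $\mathsf k[X,Y]$)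 and $\ell,\ell'\in R_1$ are linear forms. Let $\mathcal H_{P,\ell}$ be the set of all $i\in\{0,\ldots,d-1\}$ such that the $i$-th Hessian $h^i(F)=\det\big[\alpha_u\alpha_v\circ F\big]_{u,v}$, where $(\alpha_u)_u$ are forms of degree $i$ representing a basis of $A_i$, does not vanish at the point $p_\ell=(a,b)$ for $\ell=ax+by$ (this does not depend on the choice of the basis). Let $\mathcal H_{Q,\ell'}$ be the corresponding set for $G$, $A'$ and $\ell'$. Then $Q\le P$ in the dominance order, that is, $\sum_{m=0}^{i}q_m\le\sum_{m=0}^{i}p_m$ for all $i\ge 0$ (with $p_m=0$ and $q_m=0$ beyond the last part), if and only if $\mathcal H_{Q,\ell'}\subseteq\mathcal H_{P,\ell}$. -/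

import Mathlib

noncomputable section

namespace CIJordan

open MvPolynomial

/-! ### Partitions: parts in decreasing order, diagonal lengths, dominance -/

/-- The `i`-th part (counting from `0`) of a partition `p₀ ≥ p₁ ≥ ⋯`, with value `0` when `i` is at
least the number of parts. -/
def part {n : ℕ} (P : n.Partition) (i : ℕ) : ℕ :=
  (P.parts.sort (· ≥ ·)).getD i 0

/-- The length of the `m`-th diagonal of the Ferrers diagram of `P`: the number of boxes
`(r, c)` (row `r`, column `c`, both counted from `0`, so that `c < pᵣ`) with `r + c = m`. -/
def diagonalLength {n : ℕ} (P : n.Partition) (m : ℕ) : ℕ :=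
  ((Finset.HasAntidiagonal.antidiagonal m).filter fun rc => rc.2 < part P rc.1).card

/-- The sequence `T(d,k) = (1, 2, …, d - 1, d, …, d, d - 1, …, 2, 1)` in which `d` occurs `k` times,
in degrees `0, …, 2d + k - 3`, extended by `0` (for `d, k ≥ 1`). -/
def ciSequence (d k i : ℕ) : ℕ := min (min (i + 1) d) (2 * d + k - 2 - i)

/-- `Q ≤ P` in the dominance order: `q₀ + ⋯ + qᵢ ≤ p₀ + ⋯ + pᵢ` for all `i`. -/
def DominanceLE {n : ℕ} (Q P : n.Partition) : Prop :=
  ∀ i : ℕ, ∑ j ∈ Finset.range (i + 1), part Q j ≤ ∑ j ∈ Finset.range (i + 1), part P j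

/-! ### Jordan type of a nilpotent endomorphism -/

/-- `P` is the Jordan type of the (nilpotent) endomorphism `f` of `V`: there is a basis of `V`
consisting of strings `v, f v, …, f ^ (p - 1) v` with `f ^ p v = 0`, whose lengths `p` are the parts
of `P`, with multiplicity. -/
def IsJordanType {K V : Type*} [Field K] [AddCommGroup V] [Module K V]
    {n : ℕ} (P : n.Partition) (f : V →ₗ[K] V) : Prop :=
  ∃ (s : ℕ) (p : Fin s → ℕ) (b : Module.Basis (Σ i : Fin s, Fin (p i)) K V),
    P.parts = Finset.univ.val.map p ∧
    ∀ (i : Fin s) (a : Fin (p i)),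
      f (b ⟨i, a⟩) = if h : (a : ℕ) + 1 < p i then b ⟨i, ⟨a + 1, h⟩⟩ else 0

/-! ### Macaulay duality in two variables

`K[x, y]` and its dual `K[X, Y]` are both `MvPolynomial (Fin 2) K`. -/

variable {K : Type*} [Field K]

/-- The partial derivative with respect to the `i`-th variable, as a linear map. -/
def partialD (i : Fin 2) : Module.End K (MvPolynomial (Fin 2) K) := (pderiv i).toLinearMap

/-- The differential operator `∂_X ^ u ∂_Y ^ v` by which the monomial `x ^ u y ^ v` acts. -/
def diffMonomial (m : Fin 2 →₀ ℕ) : Module.End K (MvPolynomial (Fin 2) K) :=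
  partialD 0 ^ m 0 * partialD 1 ^ m 1

/-- The action `f ∘ F` of `f ∈ K[x, y]` on `F ∈ K[X, Y]` by differentiation. -/
def diffAct : MvPolynomial (Fin 2) K →ₗ[K] Module.End K (MvPolynomial (Fin 2) K) :=
  (basisMonomials (Fin 2) K).constr K diffMonomial

theorem diffAct_monomial (m : Fin 2 →₀ ℕ) (c : K) :
    diffAct (monomial m c) = c • diffMonomial m := by
  have h : (monomial m c : MvPolynomial (Fin 2) K) = c • basisMonomials (Fin 2) K m := by
    simp [smul_monomial]
  rw [h, map_smul, diffAct, Module.Basis.constr_basis]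

theorem partialD_commute :
    Commute (partialD 0 : Module.End K (MvPolynomial (Fin 2) K)) (partialD 1) := by
  have h : ⁅(pderiv 0 : Derivation K (MvPolynomial (Fin 2) K) (MvPolynomial (Fin 2) K)),
      (pderiv 1 : Derivation K (MvPolynomial (Fin 2) K) (MvPolynomial (Fin 2) K))⁆ = 0 := by
    apply MvPolynomial.derivation_ext
    intro i
    fin_cases i <;> simp [Derivation.commutator_apply, pderiv_X]
  refine LinearMap.ext fun F => ?_
  have := congrArg (fun D => D F) h
  simpa [partialD, Derivation.commutator_apply, sub_eq_zero] using this

theorem diffMonomial_add (m m' : Fin 2 →₀ ℕ) :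
    (diffMonomial (m + m') : Module.End K (MvPolynomial (Fin 2) K)) =
      diffMonomial m * diffMonomial m' := by
  simp only [diffMonomial, Finsupp.add_apply, pow_add]
  have := (partialD_commute (K := K)).pow_pow (m' 0) (m 1)
  simp only [mul_assoc]
  congr 1
  simp only [← mul_assoc]
  rw [this.eq]

theorem diffAct_mul (f g : MvPolynomial (Fin 2) K) :
    diffAct (f * g) = diffAct f * diffAct g := by
  induction f using MvPolynomial.induction_on' with
  | add p q hp hq => simp only [add_mul, map_add, hp, hq]
  | monomial m a =>
    induction g using MvPolynomial.induction_on' with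
    | add p q hp hq => simp only [mul_add, map_add, hp, hq]
    | monomial m' b =>
      rw [monomial_mul, diffAct_monomial, diffAct_monomial, diffAct_monomial, diffMonomial_add,
        smul_mul_smul_comm]

/-- The annihilator `Ann F = {f ∈ K[x, y] | f ∘ F = 0}`. -/
def Ann (F : MvPolynomial (Fin 2) K) : Ideal (MvPolynomial (Fin 2) K) where
  carrier := {f | diffAct f F = 0}
  add_mem' := by
    intro f g hf hg
    simp only [Set.mem_ofPred_eq] at *
    rw [map_add, LinearMap.add_apply, hf, hg, add_zero]
  zero_mem' := by simp
  smul_mem' := by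
    intro c f hf
    simp only [Set.mem_ofPred_eq, smul_eq_mul] at *
    rw [diffAct_mul, Module.End.mul_apply, hf, map_zero]

/-- A graded complete intersection ideal of height two in `K[x, y]`: it is generated by a regular
sequence of two homogeneous polynomials. -/
def IsGradedCompleteIntersection (I : Ideal (MvPolynomial (Fin 2) K)) : Prop :=
  ∃ (f g : MvPolynomial (Fin 2) K) (a b : ℕ), f.IsHomogeneous a ∧ g.IsHomogeneous b ∧
    RingTheory.Sequence.IsRegular (MvPolynomial (Fin 2) K) [f, g] ∧ I = Ideal.span {f, g}

/-- The linear form `ℓ = a x + b y` with coefficient vector `p_ℓ = (a, b)`. -/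
def linearForm (p : Fin 2 → K) : MvPolynomial (Fin 2) K := C (p 0) * X 0 + C (p 1) * X 1

/-- Multiplication by the class of `ℓ` on `A = K[x, y] / I`. -/
def mulByLinear (I : Ideal (MvPolynomial (Fin 2) K)) (p : Fin 2 → K) :
    (MvPolynomial (Fin 2) K ⧸ I) →ₗ[K] (MvPolynomial (Fin 2) K ⧸ I) :=
  LinearMap.mulLeft K (Ideal.Quotient.mk I (linearForm p))

/-- `P = P_{ℓ,A}` for the graded complete intersection `A = K[x, y] / Ann F`, where `F` is a form and
`ℓ` is the linear form with coefficient vector `p`. -/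
structure IsCIJordanTypeOf {n : ℕ} (P : n.Partition) (F : MvPolynomial (Fin 2) K)
    (p : Fin 2 → K) : Prop where
  homogeneous : ∃ j : ℕ, F.IsHomogeneous j
  completeIntersection : IsGradedCompleteIntersection (Ann F)
  jordanType : IsJordanType P (mulByLinear (Ann F) p)

/-! ### Hessians -/

/-- The forms `α₀, …, α_{r-1}` of degree `i` represent a basis of the graded piece `A_i` of
`A = K[x, y] / I`. -/
def IsBasisOfDegree (I : Ideal (MvPolynomial (Fin 2) K)) (i : ℕ) {r : ℕ}
    (α : Fin r → MvPolynomial (Fin 2) K) : Prop :=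
  (∀ u, (α u).IsHomogeneous i) ∧
  LinearIndependent K (fun u => Ideal.Quotient.mkₐ K I (α u)) ∧
  Submodule.span K (Set.range fun u => Ideal.Quotient.mkₐ K I (α u)) =
    (homogeneousSubmodule (Fin 2) K i).map (Ideal.Quotient.mkₐ K I).toLinearMap

/-- The Hessian matrix `[α_u α_v ∘ F]` of `F` with respect to `α`. -/
def hessianMatrix (F : MvPolynomial (Fin 2) K) {r : ℕ} (α : Fin r → MvPolynomial (Fin 2) K) :
    Matrix (Fin r) (Fin r) (MvPolynomial (Fin 2) K) :=
  Matrix.of fun u v => diffAct (α u * α v) F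

/-- `h^i_ℓ(F) ≠ 0`: the determinant of the `i`-th Hessian matrix of `F`, taken with respect to a
basis of `A_i` with `A = K[x, y] / Ann F`, does not vanish at `p_ℓ`. A change of the basis multiplies
this determinant by a nonzero constant, so the choice of the basis does not matter. -/
def HessianNonvanishing (F : MvPolynomial (Fin 2) K) (p : Fin 2 → K) (i : ℕ) : Prop :=
  ∃ (r : ℕ) (α : Fin r → MvPolynomial (Fin 2) K), IsBasisOfDegree (Ann F) i α ∧
    eval p (hessianMatrix F α).det ≠ 0

/-- The set of the `i ∈ [0, d - 1]` with `h^i_ℓ(F) ≠ 0`. -/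
def nonvanishingHessians (d : ℕ) (F : MvPolynomial (Fin 2) K) (p : Fin 2 → K) : Set ℕ :=
  {i | i < d ∧ HessianNonvanishing F p i}

end CIJordan

end

/-! Place row `r` of a partition in degrees `r, …, r + p_r - 1`, so that diagonal lengths count rows
by degree. For `ℓ ≠ 0` choose coordinates `y, ℓ` and set `ℓ = 1`: multiplication by `ℓ` becomes
invisible on univariate polynomials, and a form `F` of degree `j` becomes a functional `L`. The form
of degree `m` belonging to `g` lies in `Ann F` iff `L (g h) = 0` for all `h` of degree `≤ j - m`
(`homForm_mem_Ann_iff`). Hence the strings of `ℓ` start at monic polynomials `g_r`, one in each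
degree `r`, orthogonal to as many degrees as possible, and their lengths `orthLength` are the parts
of the Jordan type (`part_eq_orthLength`). Since `L (g h)` is symmetric, these rows are permuted by
the reflection `m ↦ j - m` (`isBalanced_orthLength`).

In a balanced partition distinct rows have distinct mirror images, so the first `x` nonempty rows
have at most `x (j + 2 - x)` boxes, with equality iff the reflection preserves them
(`IsBalanced.sum_add_sq`). For `x = i + 1 ≤ d` this closedness is nondegeneracy of `(g, h) ↦ L (g
h)` in degrees `≤ i` (`isClosedAt_orthLength_iff`). Since `ℓ ^ e ∘ H = e! H(p_ℓ)` for `H` of degree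
`e`, it is also nonvanishing of the `i`-th Hessian at `p_ℓ` (`hessianNonvanishing_iff`).

So the Hessian sets record where partial sums reach their upper bound, and dominance transfers such
equalities from `Q` to `P`. Conversely, parts can drop only after a closed segment. With the Hessian
sets included, a failure of dominance would meet no closed segment and would grow until both
partitions are exhausted (`IsBalanced.dominance_iff`). The form `ℓ = 0` is treated separately in
`exists_isBalanced`. -/

namespace CIJordan

open Finset

/-! ### Partitions with a reflection symmetry -/

/-- The sum `0 + 1 + ⋯ + (x - 1)` is the least sum of `x` distinct natural numbers, and it is attained
only by the initial segment. -/
theorem sum_range_card_le_sum (S : Finset ℕ) :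
    ∑ i ∈ range S.card, i ≤ ∑ i ∈ S, i ∧
      (∑ i ∈ S, i ≤ ∑ i ∈ range S.card, i → S = range S.card) := by
  set x := S.card with hx
  have h1 := sum_inter_add_sum_sdiff S (range x) (fun i => i)
  have h2 := sum_inter_add_sum_sdiff (range x) S (fun i => i)
  rw [inter_comm] at h2
  have hc : (S \ range x).card = (range x \ S).card := by
    apply card_sdiff_comm
    simp [hx]
  have h3 : x * (S \ range x).card ≤ ∑ i ∈ S \ range x, i := by
    rw [mul_comm, ← smul_eq_mul]
    apply card_nsmul_le_sum
    intro i hi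
    simp at hi
    exact hi.2
  -- Each missing number is at most `x - 1`, while each number of `S` outside the segment is at
  -- least `x`. The gap of one per exchange also settles the equality case.
  have h4 : ∑ i ∈ range x \ S, (i + 1) ≤ (range x \ S).card * x := by
    rw [← smul_eq_mul]
    apply sum_le_card_nsmul
    intro i hi
    simp at hi
    exact hi.1
  rw [sum_add_distrib, sum_const, smul_eq_mul, mul_one] at h4
  rw [hc, mul_comm] at h3
  refine ⟨by omega, fun h => ?_⟩
  have h5 : (range x \ S).card = 0 := by omega
  have h6 : range x ⊆ S := by
    rw [← sdiff_eq_empty_iff_subset]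
    exact card_eq_zero.1 h5
  exact (eq_of_subset_of_card_le h6 (by simp [hx])).symm

/-- The rows of a Ferrers diagram, the `r`-th one starting in degree `r`, are permuted by the
reflection `m ↦ j - m` of the degrees. -/
structure IsBalanced (p : ℕ → ℕ) (j : ℕ) : Prop where
  antitone : Antitone p
  partner : ∀ r, 0 < p r → ∃ s, r + s + p r = j + 1 ∧ p s = p r

/-- The first `x` rows are nonempty, and they are permuted by the reflection of the degrees. -/
def IsClosedAt (p : ℕ → ℕ) (j x : ℕ) : Prop :=
  ∀ r < x, 0 < p r ∧ ∃ s < x, r + s + p r = j + 1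

namespace IsBalanced

variable {p q : ℕ → ℕ} {j : ℕ}

/-- Summing `r + e r + p r = j + 1` over the rows, with `e r` the starting degree of the mirror
image, bounds the sum of the `p r` from below-estimates on `∑ e r`. The `e r` are distinct, so `∑ e
r` is least exactly when they fill `range x`. -/
theorem sum_add_sq (h : IsBalanced p j) {x : ℕ} (hx : ∀ r < x, 0 < p r) :
    ∑ r ∈ range x, p r + x * x ≤ x * (j + 2) ∧
      (∑ r ∈ range x, p r + x * x = x * (j + 2) ↔ IsClosedAt p j x) := by
  have hs : ∀ r, ∃ s, 0 < p r → r + s + p r = j + 1 ∧ p s = p r := by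
    intro r
    by_cases hr : 0 < p r
    · obtain ⟨s, hs⟩ := h.partner r hr
      exact ⟨s, fun _ => hs⟩
    · exact ⟨0, fun h' => absurd h' hr⟩
  choose e he using hs
  -- Rows with the same partner have the same length, hence the same start.
  have hinj : Set.InjOn e (range x : Finset ℕ) := by
    intro a ha b hb hab
    simp at ha hb
    have h1 := he a (hx a ha)
    have h2 := he b (hx b hb)
    have h3 : p a = p b := by rw [← h1.2, ← h2.2, hab]
    omega
  have hcard : ((range x).image e).card = x := by
    rw [card_image_of_injOn hinj, card_range]
  have hsum : ∑ i ∈ (range x).image e, i = ∑ r ∈ range x, e r := sum_image hinj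
  have key := sum_range_card_le_sum ((range x).image e)
  rw [hcard, hsum] at key
  have htot : ∑ r ∈ range x, (r + e r + p r) = x * (j + 1) := by
    rw [sum_congr rfl (fun r hr => (he r (hx r (mem_range.1 hr))).1)]
    simp
  rw [sum_add_distrib, sum_add_distrib] at htot
  have hg := Finset.sum_range_id_mul_two x
  have hg' : (∑ i ∈ range x, i) * 2 + x = x * x := by
    rw [hg]
    rcases x with _ | x
    · simp
    · simp; ring
  have hj : x * (j + 2) = x * (j + 1) + x := by ring
  refine ⟨by omega, fun heq => ?_, fun hc => ?_⟩
  · have himg := key.2 (by omega)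
    intro r hr
    refine ⟨hx r hr, e r, ?_, (he r (hx r hr)).1⟩
    rw [← mem_range, ← himg]
    exact mem_image_of_mem e (mem_range.2 hr)
  · have hsub : (range x).image e ⊆ range x := by
      intro i hi
      simp only [mem_image, mem_range] at hi
      obtain ⟨r, hr, rfl⟩ := hi
      obtain ⟨s, hs, hrs⟩ := (hc r hr).2
      have := (he r (hx r hr)).1
      rw [mem_range]
      omega
    have himg := eq_of_subset_of_card_le hsub (by rw [hcard, card_range])
    rw [himg] at hsum
    omega

/-- Partners have equal length, so a row before the drop cannot have its partner after it. -/
theorem isClosedAt_of_lt (h : IsBalanced p j) {x : ℕ} (hlt : p (x + 1) < p x) :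
    IsClosedAt p j (x + 1) := by
  intro r hr
  have h1 : p x ≤ p r := h.antitone (by omega)
  obtain ⟨s, hs, hps⟩ := h.partner r (by omega)
  refine ⟨by omega, s, ?_, hs⟩
  by_contra hcon
  have := h.antitone (not_lt.1 hcon)
  omega

theorem le_add_one (h : IsBalanced p j) {r : ℕ} (hr : 0 < p r) : r + p r ≤ j + 1 := by
  obtain ⟨s, hs, -⟩ := h.partner r hr
  omega

end IsBalanced

/-- The number of boxes on the `m`-th diagonal of the Ferrers diagram with rows `p`. -/
def diagonalCount (p : ℕ → ℕ) (m : ℕ) : ℕ :=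
  ((antidiagonal m).filter fun rc => rc.2 < p rc.1).card

theorem diagonalCount_pos_iff (p : ℕ → ℕ) (m : ℕ) :
    0 < diagonalCount p m ↔ ∃ r s, r + s = m ∧ s < p r := by
  simp [diagonalCount, card_pos, Finset.Nonempty]

/-- Removing the two outer ones and lowering every other term by one turns the sequence for `d + 2`
into that for `d + 1`. -/
theorem sum_ciSequence (d k : ℕ) (hk : 1 ≤ k) :
    ∑ i ∈ range (2 * (d + 1) + k - 2), ciSequence (d + 1) k i = (d + 1) * (d + k) := by
  induction d with
  | zero =>
    have h : ∀ i ∈ range (2 * (0 + 1) + k - 2), ciSequence (0 + 1) k i = 1 := by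
      intro i hi
      simp only [mem_range] at hi
      simp only [ciSequence]
      omega
    rw [sum_congr rfl h]
    simp
  | succ d ih =>
    have e1 : 2 * (d + 1 + 1) + k - 2 = (2 * (d + 1) + k - 2) + 1 + 1 := by omega
    rw [e1, sum_range_succ, sum_range_succ']
    have h : ∀ i ∈ range (2 * (d + 1) + k - 2),
        ciSequence (d + 1 + 1) k (i + 1) = ciSequence (d + 1) k i + 1 := by
      intro i hi
      simp only [mem_range] at hi
      simp only [ciSequence]
      omega
    rw [sum_congr rfl h, sum_add_distrib, ih]
    have h0 : ciSequence (d + 1 + 1) k 0 = 1 := by simp only [ciSequence]; omega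
    have h1 : ciSequence (d + 1 + 1) k (2 * (d + 1) + k - 2 + 1) = 1 := by
      simp only [ciSequence]; omega
    have h2 : 2 * (d + 1) + k - 2 = 2 * d + k := by omega
    rw [h0, h1, sum_const, card_range, smul_eq_mul, h2]
    ring

/-! ### Balanced partitions with diagonal lengths `T(d,k)` -/

namespace IsBalanced

variable {p q : ℕ → ℕ} {j d k : ℕ}

/-- Diagonal `d - 1` has `d` boxes, so it is completely filled. -/
theorem pos_of_lt (hd : 1 ≤ d) (hk : 1 ≤ k) (hT : ∀ m, diagonalCount p m = ciSequence d k m)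
    {r : ℕ} (hr : r < d) : d - 1 - r < p r := by
  have h := hT (d - 1)
  have h1 : ciSequence d k (d - 1) = d := by simp only [ciSequence]; omega
  have h2 : (antidiagonal (d - 1)).card = d := by simp; omega
  rw [h1] at h
  replace h := h.trans h2.symm
  rw [diagonalCount, card_filter_eq_iff] at h
  exact h (r, d - 1 - r) (by simp; omega)

theorem socleDegree_eq (h : IsBalanced p j) (hd : 1 ≤ d) (hk : 1 ≤ k)
    (hT : ∀ m, diagonalCount p m = ciSequence d k m) : j + 3 = 2 * d + k := by
  have h0 : 0 < p 0 := by
    have := pos_of_lt hd hk hT (show 0 < d by omega)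
    omega
  obtain ⟨s, hs, hps⟩ := h.partner 0 h0
  -- The mirror image of row `0` ends in degree `j`, which is thus the last nonempty diagonal.
  have h1 : 0 < diagonalCount p j :=
    (diagonalCount_pos_iff p j).2 ⟨s, p 0 - 1, by omega, by omega⟩
  have h2 : ¬ 0 < diagonalCount p (j + 1) := by
    rw [diagonalCount_pos_iff]
    rintro ⟨r, c, hrc, hc⟩
    have := h.le_add_one (r := r) (by omega)
    omega
  rw [hT] at h1 h2
  simp only [ciSequence] at h1 h2
  omega

theorem sum_eq (h : IsBalanced p j) (hd : 1 ≤ d) (hk : 1 ≤ k)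
    (hT : ∀ m, diagonalCount p m = ciSequence d k m) :
    ∑ r ∈ range (j + 1), p r = d * (d + k - 1) := by
  have hj := h.socleDegree_eq hd hk hT
  obtain ⟨d, rfl⟩ := Nat.exists_eq_add_of_le' hd
  have h1 := sum_ciSequence d k hk
  have h2 : 2 * (d + 1) + k - 2 = j + 1 := by omega
  rw [h2] at h1
  rw [show d + 1 + k - 1 = d + k by omega, ← h1]
  have h3 : ∀ m, ciSequence (d + 1) k m =
      ∑ r ∈ range (m + 1), if m - r < p r then 1 else 0 := by
    intro m
    rw [← hT, diagonalCount, card_filter, Finset.Nat.sum_antidiagonal_eq_sum_range_succ_mk]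
  simp_rw [h3]
  rw [sum_range_diag_flip (j + 1) (fun r c => if c < p r then 1 else 0)]
  refine sum_congr rfl fun r hr => ?_
  rw [← card_filter]
  have h4 : (range (j + 1 - r)).filter (fun c => c < p r) = range (p r) := by
    ext c
    simp only [mem_filter, mem_range]
    refine ⟨fun hc => hc.2, fun hc => ⟨?_, hc⟩⟩
    have := h.le_add_one (r := r) (by omega)
    omega
  rw [h4, card_range]

theorem eq_zero_of_le (h : IsBalanced p j) {r : ℕ} (hr : j + 1 ≤ r) : p r = 0 := by
  by_contra hp
  have := h.le_add_one (Nat.pos_of_ne_zero hp)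
  omega

theorem sum_le (h : IsBalanced p j) (x : ℕ) :
    ∑ r ∈ range x, p r ≤ ∑ r ∈ range (j + 1), p r := by
  apply sum_le_sum_of_ne_zero
  intro r hr hp
  rw [mem_range]
  by_contra hcon
  exact hp (h.eq_zero_of_le (by omega))

theorem sum_eq_of_eq_zero (h : IsBalanced p j) {x : ℕ} (hx : p x = 0) :
    ∑ r ∈ range x, p r = ∑ r ∈ range (j + 1), p r := by
  refine le_antisymm (h.sum_le x) (sum_le_sum_of_ne_zero ?_)
  intro r hr hp
  rw [mem_range]
  by_contra hcon
  have := h.antitone (not_lt.1 hcon)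
  omega

/-- With `e = d + k - 1` one has `j + 2 = d + e` and `S = x (d + e - x)`, so `S ≤ d e` reads `(x -
d) (x - e) ≥ 0`. A closed segment therefore cannot end strictly between `d` and `e`. -/
theorem eq_or_eq_of_isClosedAt_of_sum_eq (hj : j + 3 = 2 * d + k) {S x : ℕ}
    (hx : S + x * x = x * (j + 2)) (hS : S ≤ d * (d + k - 1)) : x ≤ d ∨ d + k - 1 ≤ x := by
  by_contra! hcon
  obtain ⟨a, ha⟩ := Nat.exists_eq_add_of_lt hcon.1
  obtain ⟨b, hb⟩ := Nat.exists_eq_add_of_lt hcon.2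
  have hj' : j + 2 = d + (d + k - 1) := by omega
  rw [hj', hb, ha] at hx
  rw [hb, ha] at hS
  nlinarith

theorem vanishes (h : IsBalanced p j) (hd : 1 ≤ d) (hk : 1 ≤ k)
    (hT : ∀ m, diagonalCount p m = ciSequence d k m) : p (d + k - 1) = 0 := by
  have hj := h.socleDegree_eq hd hk hT
  have hn := h.sum_eq hd hk hT
  have hex : ∃ t, p t = 0 := ⟨j + 1, h.eq_zero_of_le le_rfl⟩
  classical
  obtain ⟨t, ht, hmin⟩ : ∃ t, p t = 0 ∧ ∀ r < t, 0 < p r :=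
    ⟨Nat.find hex, Nat.find_spec hex, fun r hr => Nat.pos_of_ne_zero (Nat.find_min hex hr)⟩
  rcases t with _ | t
  · exact Nat.le_zero.1 (ht ▸ h.antitone (Nat.zero_le _))
  -- The set of all nonempty rows is closed. Its size therefore satisfies `(t + 1) (d + e - (t + 1))
  -- = d e` with `e = d + k - 1`, which rules out sizes above `e`.
  have hc : IsClosedAt p j (t + 1) :=
    h.isClosedAt_of_lt (by rw [ht]; exact hmin t (by omega))
  have h1 := (h.sum_add_sq hmin).2.2 hc
  rw [h.sum_eq_of_eq_zero ht, hn] at h1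
  have h2 : t + 1 ≤ d + k - 1 := by
    by_contra! hcon
    obtain ⟨a, ha⟩ := Nat.exists_eq_add_of_lt hcon
    obtain ⟨b, hb⟩ : ∃ b, d + k - 1 = d + b := ⟨k - 1, by omega⟩
    have hj' : j + 2 = d + (d + k - 1) := by omega
    rw [hj', ha, hb] at h1
    nlinarith
  exact Nat.le_zero.1 (ht ▸ h.antitone h2)

/-- Dominance of balanced partitions with diagonal lengths `T(d,k)` is inclusion of their sets of
closed initial segments. -/
theorem dominance_iff (hp : IsBalanced p j) (hq : IsBalanced q j) (hd : 1 ≤ d) (hk : 1 ≤ k)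
    (hpT : ∀ m, diagonalCount p m = ciSequence d k m)
    (hqT : ∀ m, diagonalCount q m = ciSequence d k m) :
    (∀ x, ∑ r ∈ range (x + 1), q r ≤ ∑ r ∈ range (x + 1), p r) ↔
      ∀ i < d, IsClosedAt q j (i + 1) → IsClosedAt p j (i + 1) := by
  have hj := hp.socleDegree_eq hd hk hpT
  have hpn := hp.sum_eq hd hk hpT
  have hqn := hq.sum_eq hd hk hqT
  have hp0 : ∀ r < d, 0 < p r := fun r hr => by
    have := pos_of_lt hd hk hpT hr
    omega
  have hq0 : ∀ r < d, 0 < q r := fun r hr => by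
    have := pos_of_lt hd hk hqT hr
    omega
  constructor
  · intro hdom i hi hcl
    have h1 := (hq.sum_add_sq (x := i + 1) fun r hr => hq0 r (by omega)).2.2 hcl
    have h2 := hp.sum_add_sq (x := i + 1) fun r hr => hp0 r (by omega)
    have h3 := hdom i
    exact h2.2.1 (by omega)
  · intro hcl
    by_contra! hcon
    obtain ⟨x, hx⟩ := hcon
    have hex : ∃ x, ∑ r ∈ range x, p r < ∑ r ∈ range x, q r := ⟨x + 1, hx⟩
    classical
    obtain ⟨x, hx, hmin⟩ : ∃ x, ∑ r ∈ range x, p r < ∑ r ∈ range x, q r ∧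
        ∀ y < x, ∑ r ∈ range y, q r ≤ ∑ r ∈ range y, p r :=
      ⟨Nat.find hex, Nat.find_spec hex, fun r hr => not_lt.1 (Nat.find_min hex hr)⟩
    rcases x with _ | x
    · simp at hx
    have h0 := hmin x (by omega)
    have hlast : ∀ y, d + k - 1 ≤ y → ∑ r ∈ range y, q r ≤ ∑ r ∈ range y, p r := by
      intro y hy
      have := hp.antitone hy
      rw [hp.vanishes hd hk hpT] at this
      rw [hp.sum_eq_of_eq_zero (by omega), hpn, ← hqn]
      exact hq.sum_le y
    have hxe : x + 1 < d + k - 1 := by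
      by_contra hcon
      have := hlast (x + 1) (by omega)
      omega
    -- Past the first violation both partitions stay constant: a closed segment of `p` would have
    -- the maximal sum, and one of `q` would force one of `p`. The excess of `q` survives up to `d +
    -- k - 1`, where `p` already contains all its boxes.
    have key : ∀ y, x ≤ y → y < d + k - 1 →
        p y < q y ∧ ∑ r ∈ range (y + 1), p r < ∑ r ∈ range (y + 1), q r := by
      intro y hy
      induction y, hy using Nat.le_induction with
      | base =>
        intro _
        refine ⟨?_, hx⟩
        rw [sum_range_succ, sum_range_succ] at hx
        omega
      | succ y hy ih =>
        intro hye
        obtain ⟨h1, h2⟩ := ih (by omega)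
        have hpc : ¬ IsClosedAt p j (y + 1) := by
          intro hc
          have h3 := (hp.sum_add_sq fun r hr => (hc r hr).1).2.2 hc
          have h4 := hp.sum_le (y + 1)
          rcases eq_or_eq_of_isClosedAt_of_sum_eq hj h3 (hpn ▸ h4) with h5 | h5
          · have h6 := (hq.sum_add_sq (x := y + 1) fun r hr => hq0 r (by omega)).1
            omega
          · omega
        have hqc : ¬ IsClosedAt q j (y + 1) := by
          intro hc
          have h3 := (hq.sum_add_sq fun r hr => (hc r hr).1).2.2 hc
          have h4 := hq.sum_le (y + 1)
          rcases eq_or_eq_of_isClosedAt_of_sum_eq hj h3 (hqn ▸ h4) with h5 | h5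
          · exact hpc (hcl y (by omega) hc)
          · omega
        have hpe : p (y + 1) = p y :=
          le_antisymm (hp.antitone (by omega)) (not_lt.1 fun hlt => hpc (hp.isClosedAt_of_lt hlt))
        have hqe : q (y + 1) = q y :=
          le_antisymm (hq.antitone (by omega)) (not_lt.1 fun hlt => hqc (hq.isClosedAt_of_lt hlt))
        refine ⟨by omega, ?_⟩
        rw [sum_range_succ, sum_range_succ _ (y + 1)]
        omega
    have h7 := key (d + k - 2) (by omega) (by omega)
    have h8 := hlast (d + k - 2 + 1) (by omega)
    omega

end IsBalanced

end CIJordan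

namespace CIJordan

/-! ### Formal orthogonal polynomials -/

section Orthogonal

open Polynomial

variable {K : Type*} [Field K] (L : K[X] →ₗ[K] K)

/-- `g` is orthogonal, with respect to the functional `L`, to all polynomials of degree `< e`. -/
def IsOrth (e : ℕ) (g : K[X]) : Prop :=
  ∀ h ∈ degreeLT K e, L (g * h) = 0

variable {L}

theorem IsOrth.mono {e e' : ℕ} {g : K[X]} (h : IsOrth L e g) (he : e' ≤ e) : IsOrth L e' g :=
  fun u hu => h u (degreeLT_mono he hu)

theorem IsOrth.zero (g : K[X]) : IsOrth L 0 g := by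
  intro u hu
  rw [mem_degreeLT, Nat.cast_zero, Nat.WithBot.lt_zero_iff, degree_eq_bot] at hu
  simp [hu]

theorem IsOrth.X_mul {e : ℕ} {g : K[X]} (h : IsOrth L (e + 1) g) : IsOrth L e (X * g) := by
  intro u hu
  rw [mul_comm X, mul_assoc]
  apply h
  rw [mem_degreeLT] at hu ⊢
  by_cases h0 : u = 0
  · simp only [h0, mul_zero, degree_zero]
    exact WithBot.bot_lt_coe _
  · rw [← natDegree_lt_iff_degree_lt h0] at hu
    rw [← natDegree_lt_iff_degree_lt (mul_ne_zero X_ne_zero h0), natDegree_X_mul h0]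
    omega

theorem IsOrth.C_mul {e : ℕ} {g : K[X]} (h : IsOrth L e g) (c : K) : IsOrth L e (C c * g) := by
  intro u hu
  rw [mul_assoc, ← smul_eq_C_mul, map_smul, h u hu, smul_zero]

theorem isOrth_succ_iff {e : ℕ} {g : K[X]} :
    IsOrth L (e + 1) g ↔ IsOrth L e g ∧ L (g * X ^ e) = 0 := by
  refine ⟨fun h => ⟨h.mono (Nat.le_succ e), h _ ?_⟩, fun ⟨h1, h2⟩ u hu => ?_⟩
  · rw [mem_degreeLT, degree_X_pow]
    exact_mod_cast Nat.lt_succ_self e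
  · have h3 : u - C (u.coeff e) * X ^ e ∈ degreeLT K e := by
      rw [mem_degreeLT, degree_lt_iff_coeff_zero] at *
      intro m hm
      rcases hm.eq_or_lt with rfl | hm
      · simp
      · rw [coeff_sub, hu m hm, coeff_C_mul, coeff_X_pow, if_neg hm.ne']
        simp
    have h4 := h1 _ h3
    rw [mul_sub, map_sub, mul_left_comm, ← smul_eq_C_mul, map_smul, h2, smul_zero, sub_zero] at h4
    exact h4

/-- If no monic polynomial of degree `s` is orthogonal to all polynomials of degree `< r`, then the
leading coefficient on polynomials of degree `≤ s` is represented by a polynomial of degree `< r`. -/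
theorem exists_represents_coeff {r s : ℕ}
    (h : ∀ g : K[X], g.Monic → g.natDegree = s → ¬ IsOrth L r g) :
    ∃ u ∈ degreeLT K r, ∀ g ∈ degreeLT K (s + 1), L (u * g) = g.coeff s := by
  let φ : Fin r → (degreeLT K (s + 1) →ₗ[K] K) := fun i =>
    (L ∘ₗ LinearMap.mulLeft K (X ^ (i : ℕ))) ∘ₗ (degreeLT K (s + 1)).subtype
  let ψ : degreeLT K (s + 1) →ₗ[K] K := lcoeff K s ∘ₗ (degreeLT K (s + 1)).subtype
  -- A polynomial of degree exactly `s` killed by all the `φ i` would, made monic, contradict `h`.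
  -- Hence `ψ` is a combination of the `φ i`, whose coefficients are those of `u`.
  have hker : ⨅ i, LinearMap.ker (φ i) ≤ LinearMap.ker ψ := by
    rintro ⟨g, hg⟩ hgk
    rw [LinearMap.mem_ker]
    by_contra hne
    change g.coeff s ≠ 0 at hne
    have hdeg : g.natDegree = s := by
      apply le_antisymm
      · rw [mem_degreeLT] at hg
        rw [natDegree_le_iff_coeff_eq_zero]
        exact fun m hm => (degree_lt_iff_coeff_zero _ _).1 hg m hm
      · exact le_natDegree_of_ne_zero hne
    have hg0 : g ≠ 0 := by
      rintro rfl
      simp at hne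
    have horth : IsOrth L r g := by
      have : ∀ e ≤ r, IsOrth L e g := by
        intro e
        induction e with
        | zero => exact fun _ => IsOrth.zero g
        | succ e ih =>
          intro he
          refine isOrth_succ_iff.2 ⟨ih (by omega), ?_⟩
          rw [Submodule.mem_iInf] at hgk
          have := hgk ⟨e, he⟩
          rw [LinearMap.mem_ker] at this
          rw [mul_comm]
          exact this
      exact this r le_rfl
    refine h (C g.leadingCoeff⁻¹ * g) ?_ ?_ (horth.C_mul _)
    · rw [mul_comm]
      exact monic_mul_leadingCoeff_inv hg0
    · rw [natDegree_C_mul (inv_ne_zero (leadingCoeff_ne_zero.2 hg0)), hdeg]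
  have hmem := mem_span_of_iInf_ker_le_ker hker
  rw [Submodule.mem_span_range_iff_exists_fun] at hmem
  obtain ⟨c, hc⟩ := hmem
  refine ⟨∑ i, c i • X ^ (i : ℕ), ?_, ?_⟩
  · refine Submodule.sum_mem _ fun i _ => Submodule.smul_mem _ _ ?_
    rw [mem_degreeLT, degree_X_pow]
    exact_mod_cast i.2
  · intro g hg
    have h1 := congrArg (fun f => f ⟨g, hg⟩) hc
    simp only [LinearMap.sum_apply, LinearMap.smul_apply, φ, ψ] at h1
    simpa [Finset.sum_mul] using h1

/-! ### Lengths of orthogonality and their reflection symmetry -/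

variable (L) (j : ℕ)

theorem exists_orthLength (r : ℕ) :
    ∃ c, ∃ g : K[X], g.Monic ∧ g.natDegree = r ∧ IsOrth L (j + 1 - r - c) g :=
  ⟨j + 1 - r, X ^ r, monic_X_pow r, natDegree_X_pow r, by rw [Nat.sub_self]; exact IsOrth.zero _⟩

open Classical in
/-- The least `c` such that some monic polynomial of degree `r` is orthogonal to all polynomials of
degree `≤ j - r - c`. -/
noncomputable def orthLength (r : ℕ) : ℕ := Nat.find (exists_orthLength L j r)

theorem orthLength_spec (r : ℕ) :
    ∃ g : K[X], g.Monic ∧ g.natDegree = r ∧ IsOrth L (j + 1 - r - orthLength L j r) g := by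
  classical
  exact Nat.find_spec (exists_orthLength L j r)

variable {L j}

theorem orthLength_le {r c : ℕ} {g : K[X]} (hg : g.Monic) (hr : g.natDegree = r)
    (ho : IsOrth L (j + 1 - r - c) g) : orthLength L j r ≤ c := by
  classical
  exact Nat.find_min' _ ⟨g, hg, hr, ho⟩

/-- A nonzero polynomial bounds the orthogonality length in its degree. -/
theorem orthLength_natDegree_le {L : K[X] →ₗ[K] K} {g : K[X]} (hg : g ≠ 0) {c : ℕ}
    (ho : IsOrth L (j + 1 - g.natDegree - c) g) : orthLength L j g.natDegree ≤ c := by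
  refine orthLength_le (g := C g.leadingCoeff⁻¹ * g) ?_ ?_ (ho.C_mul _)
  · rw [mul_comm]
    exact monic_mul_leadingCoeff_inv hg
  · rw [natDegree_C_mul (inv_ne_zero (leadingCoeff_ne_zero.2 hg))]

theorem orthLength_le_sub (r : ℕ) : orthLength L j r ≤ j + 1 - r :=
  orthLength_le (monic_X_pow r) (natDegree_X_pow r) (by rw [Nat.sub_self]; exact IsOrth.zero _)

/-- Multiplication by `X` costs one order of orthogonality, which gives monotonicity. The partner
`s` of `r` is the largest order of orthogonality of a monic polynomial of degree `r`, and the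
symmetry of `L (g h)` exchanges the two degrees. -/
theorem isBalanced_orthLength : IsBalanced (orthLength L j) j where
  antitone := by
    refine antitone_nat_of_succ_le fun r => ?_
    obtain ⟨g, hg, hr, ho⟩ := orthLength_spec L j r
    refine orthLength_le (monic_X.mul hg) (by rw [natDegree_X_mul hg.ne_zero, hr]) ?_
    rcases Nat.eq_zero_or_pos (j + 1 - (r + 1) - orthLength L j r) with h0 | h0
    · rw [h0]
      exact IsOrth.zero _
    · exact (ho.mono (by omega)).X_mul
  partner := by
    intro r hr
    have hle := orthLength_le_sub (L := L) (j := j) r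
    obtain ⟨s, hs⟩ : ∃ s, r + s + orthLength L j r = j + 1 :=
      ⟨j + 1 - r - orthLength L j r, by omega⟩
    refine ⟨s, hs, ?_⟩
    obtain ⟨g, hg, hgr, ho⟩ := orthLength_spec L j r
    rw [show j + 1 - r - orthLength L j r = s by omega] at ho
    have hno : ∀ g' : K[X], g'.Monic → g'.natDegree = r → ¬ IsOrth L (s + 1) g' := by
      intro g' hg' hr' ho'
      have := orthLength_le (L := L) (j := j) (c := orthLength L j r - 1) hg' hr'
        (ho'.mono (by omega))
      omega
    have hmemdeg : ∀ (f : K[X]) (m : ℕ), f.natDegree = m → f ∈ degreeLT K (m + 1) := by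
      intro f m hm
      rw [mem_degreeLT]
      refine lt_of_le_of_lt degree_le_natDegree ?_
      rw [hm]
      exact_mod_cast Nat.lt_succ_self m
    apply le_antisymm
    · by_contra hcon
      have hrep : ∀ h : K[X], h.Monic → h.natDegree = s → ¬ IsOrth L r h := by
        intro h hh hhs hho
        exact hcon (orthLength_le hh hhs (hho.mono (by omega)))
      -- Subtracting a multiple of `u` from `g` keeps it monic of degree `r` and kills the pairing
      -- with `X ^ s`, contradicting the maximality of `s`.
      obtain ⟨u, hu, hrepr⟩ := exists_represents_coeff hrep
      have hlt : (C (L (g * X ^ s)) * u).degree < g.degree := by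
        rw [degree_eq_natDegree hg.ne_zero, hgr, ← smul_eq_C_mul, ← mem_degreeLT]
        exact Submodule.smul_mem _ _ hu
      refine hno (g - C (L (g * X ^ s)) * u) ?_ ?_ ?_
      · exact hg.sub_of_left hlt
      · rw [natDegree_eq_of_degree_eq (degree_sub_eq_left_of_degree_lt hlt), hgr]
      · rw [isOrth_succ_iff]
        refine ⟨fun h hh => ?_, ?_⟩
        · rw [sub_mul, map_sub, ho h hh, mul_assoc, ← smul_eq_C_mul, map_smul,
            hrepr h (degreeLT_mono (Nat.le_succ s) hh)]
          rw [mem_degreeLT, degree_lt_iff_coeff_zero] at hh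
          rw [hh s le_rfl, smul_zero, sub_zero]
        · rw [sub_mul, map_sub, mul_assoc, ← smul_eq_C_mul, map_smul,
            hrepr _ (hmemdeg _ _ (natDegree_X_pow s))]
          simp
    · by_contra! hcon
      obtain ⟨h, hh, hhs, hho⟩ := orthLength_spec L j s
      replace hho := hho.mono (show r + 1 ≤ _ by omega)
      refine hno g hg hgr (isOrth_succ_iff.2 ⟨ho, ?_⟩)
      -- Since `g` is orthogonal to this difference and `h` is orthogonal to `g`, also `L (g X ^ s)
      -- = 0`, again contradicting maximality.
      have h1 : X ^ s - h ∈ degreeLT K s := by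
        rw [mem_degreeLT]
        have := degree_sub_lt_left (p := X ^ s) (q := h)
          (by rw [degree_X_pow, degree_eq_natDegree hh.ne_zero, hhs])
          (pow_ne_zero _ X_ne_zero) (by rw [leadingCoeff_X_pow, hh.leadingCoeff])
        rwa [degree_X_pow] at this
      have h2 := ho _ h1
      have h3 := hho g (hmemdeg _ _ hgr)
      rw [mul_comm] at h3
      rw [mul_sub, map_sub, h3, sub_zero] at h2
      exact h2

/-- The partner of `r` exceeds `i` exactly when some monic polynomial of degree `r` is orthogonal to
all degrees `≤ i`, that is, when it lies in the radical of the form on degrees `≤ i`. -/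
theorem isClosedAt_orthLength_iff {i : ℕ} (hi : 2 * i ≤ j)
    (hpos : ∀ r < i + 1, 0 < orthLength L j r) :
    IsClosedAt (orthLength L j) j (i + 1) ↔
      ∀ g ∈ degreeLT K (i + 1), IsOrth L (i + 1) g → g = 0 := by
  constructor
  · intro hc g hg ho
    by_contra hg0
    rw [mem_degreeLT, ← natDegree_lt_iff_degree_lt hg0] at hg
    obtain ⟨-, s, hs, hrs⟩ := hc g.natDegree hg
    have h1 : orthLength L j g.natDegree ≤ j - g.natDegree - i :=
      orthLength_natDegree_le hg0 (ho.mono (by omega))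
    omega
  · intro hnd r hr
    refine ⟨hpos r hr, ?_⟩
    have hle := orthLength_le_sub (L := L) (j := j) r
    refine ⟨j + 1 - r - orthLength L j r, ?_, by have := hpos r hr; omega⟩
    by_contra! hcon
    obtain ⟨g, hg, hgr, ho⟩ := orthLength_spec L j r
    refine hg.ne_zero (hnd g ?_ (ho.mono hcon))
    rw [mem_degreeLT, degree_eq_natDegree hg.ne_zero, hgr]
    exact_mod_cast hr

end Orthogonal

end CIJordan

namespace CIJordan

/-! ### Uniqueness of the Jordan type -/

section Jordan

variable {K V : Type*} [Field K] [AddCommGroup V] [Module K V]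

/-- The basis `b` consists of strings of lengths `p i` for the endomorphism `f`. -/
def IsJordanBasis {s : ℕ} {p : Fin s → ℕ} (b : Module.Basis (Σ i : Fin s, Fin (p i)) K V)
    (f : V →ₗ[K] V) : Prop :=
  ∀ (i : Fin s) (a : Fin (p i)),
    f (b ⟨i, a⟩) = if h : (a : ℕ) + 1 < p i then b ⟨i, ⟨a + 1, h⟩⟩ else 0

variable {s : ℕ} {p : Fin s → ℕ} {b : Module.Basis (Σ i : Fin s, Fin (p i)) K V} {f : V →ₗ[K] V}

theorem IsJordanBasis.pow_apply (hb : IsJordanBasis b f) (c : ℕ) (i : Fin s) (a : Fin (p i)) :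
    (f ^ c) (b ⟨i, a⟩) = if h : (a : ℕ) + c < p i then b ⟨i, ⟨a + c, h⟩⟩ else 0 := by
  induction c with
  | zero => simp
  | succ c ih =>
    rw [pow_succ', Module.End.mul_apply, ih]
    by_cases h : (a : ℕ) + c < p i
    · rw [dif_pos h, hb]
      rfl
    · rw [dif_neg h, map_zero, dif_neg (by omega)]

theorem IsJordanBasis.range_pow (hb : IsJordanBasis b f) (c : ℕ) :
    LinearMap.range (f ^ c) = Submodule.span K (b '' {x | c ≤ (x.2 : ℕ)}) := by
  rw [LinearMap.range_eq_map, ← b.span_eq, Submodule.map_span]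
  apply le_antisymm
  · rw [Submodule.span_le]
    rintro _ ⟨_, ⟨⟨i, a⟩, rfl⟩, rfl⟩
    rw [hb.pow_apply]
    split_ifs with h
    · exact Submodule.subset_span ⟨⟨i, ⟨a + c, h⟩⟩, by simp, rfl⟩
    · exact Submodule.zero_mem _
  · rw [Submodule.span_le]
    rintro _ ⟨⟨i, a⟩, ha, rfl⟩
    have ha' : c ≤ (a : ℕ) := ha
    refine Submodule.subset_span ⟨_, ⟨⟨i, ⟨a - c, by omega⟩⟩, rfl⟩, ?_⟩
    rw [hb.pow_apply]
    have h : (a : ℕ) - c + c = a := by omega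
    simp [h]

theorem IsJordanBasis.finrank_range_pow (hb : IsJordanBasis b f) (c : ℕ) :
    Module.finrank K (LinearMap.range (f ^ c)) = ∑ i, (p i - c) := by
  classical
  have hli := b.linearIndependent.comp
    (Subtype.val : {x : Σ i : Fin s, Fin (p i) // c ≤ (x.2 : ℕ)} → _) Subtype.val_injective
  have hrange : b '' {x | c ≤ (x.2 : ℕ)} = Set.range (b ∘ (Subtype.val :
      {x : Σ i : Fin s, Fin (p i) // c ≤ (x.2 : ℕ)} → _)) := Set.image_eq_range _ _
  rw [hb.range_pow, hrange, finrank_span_eq_card hli,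
    Fintype.card_subtype, Finset.card_filter, Fintype.sum_sigma]
  refine Finset.sum_congr rfl fun i _ => ?_
  rw [← Finset.card_filter, ← Nat.card_Ico c (p i),
    ← Finset.card_map (Fin.valEmbedding (n := p i))]
  congr 1
  ext m
  simp only [Finset.mem_map, Finset.mem_filter, Finset.mem_univ, true_and, Fin.valEmbedding_apply,
    Finset.mem_Ico]
  exact ⟨by rintro ⟨a, ha, rfl⟩; exact ⟨ha, a.2⟩, fun ⟨h1, h2⟩ => ⟨⟨m, h2⟩, h1, rfl⟩⟩

/-- The number of strings longer than `c` is the drop in rank from `f ^ c` to `f ^ (c + 1)`, which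
does not depend on the basis. -/
theorem IsJordanBasis.card_lt_eq (hb : IsJordanBasis b f) {s' : ℕ} {p' : Fin s' → ℕ}
    {b' : Module.Basis (Σ i : Fin s', Fin (p' i)) K V} (hb' : IsJordanBasis b' f) (c : ℕ) :
    ((Finset.univ : Finset (Fin s)).filter fun i => c < p i).card =
      ((Finset.univ : Finset (Fin s')).filter fun i => c < p' i).card := by
  have key : ∀ {m : ℕ} (q : Fin m → ℕ), ∑ i, (q i - c) =
      ∑ i, (q i - (c + 1)) + ((Finset.univ : Finset (Fin m)).filter fun i => c < q i).card := by
    intro m q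
    rw [Finset.card_filter, ← Finset.sum_add_distrib]
    refine Finset.sum_congr rfl fun i _ => ?_
    split_ifs <;> omega
  have h1 := key p
  have h2 := key p'
  rw [← hb.finrank_range_pow, ← hb.finrank_range_pow] at h1
  rw [← hb'.finrank_range_pow, ← hb'.finrank_range_pow] at h2
  omega

end Jordan

/-- Both sides say that the box `(r, c)` lies in the Ferrers diagram, read by rows and by columns.
-/
theorem lt_getD_iff_lt_countP {l : List ℕ} (hl : l.Pairwise (· ≥ ·)) (c r : ℕ) :
    c < l.getD r 0 ↔ r < l.countP (c < ·) := by
  induction l generalizing r with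
  | nil => simp
  | cons a l ih =>
    rw [List.pairwise_cons] at hl
    by_cases hca : c < a
    · rw [List.countP_cons_of_pos (by simpa using hca)]
      rcases r with _ | r
      · simp [hca]
      · rw [List.getD_cons_succ, ih hl.2]
        omega
    · have h0 : l.countP (c < ·) = 0 := by
        rw [List.countP_eq_zero]
        intro m hm
        have := hl.1 m hm
        simp
        omega
      rw [List.countP_cons_of_neg (by simpa using hca), h0]
      rcases r with _ | r
      · simp [hca]
      · rw [List.getD_cons_succ, ih hl.2, h0]
        simp

/-- An antitone function is the sequence of parts of `P` as soon as it takes values `> c` as often as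
the parts of `P`, for all `c`. -/
theorem part_eq_of_card_filter_eq {n : ℕ} (P : n.Partition) {t : ℕ} {p : ℕ → ℕ} (hp : Antitone p)
    (hp0 : p t = 0)
    (h : ∀ c, P.parts.countP (c < ·) = ((Finset.range t).filter fun r => c < p r).card) :
    part P = p := by
  have h1 : ∀ c r, c < part P r ↔ r < P.parts.countP (c < ·) := by
    intro c r
    rw [part, lt_getD_iff_lt_countP (P.parts.pairwise_sort (· ≥ ·))]
    conv_rhs => rw [← P.parts.sort_eq (· ≥ ·), Multiset.coe_countP]
  have h2 : ∀ c r, c < p r ↔ r < ((Finset.range t).filter fun r => c < p r).card := by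
    intro c r
    constructor
    · intro hc
      rw [← Nat.succ_le_iff, ← Finset.card_range r.succ]
      refine Finset.card_le_card fun m hm => ?_
      have hm' : p r ≤ p m := hp (Nat.lt_succ_iff.1 (Finset.mem_range.1 hm))
      refine Finset.mem_filter.2 ⟨Finset.mem_range.2 ?_, by omega⟩
      by_contra! hcon
      have := hp hcon
      omega
    · intro hr
      by_contra! hc
      have hsub : ((Finset.range t).filter fun r => c < p r) ⊆ Finset.range r := by
        intro m hm
        have hm' := (Finset.mem_filter.1 hm).2
        rw [Finset.mem_range]
        by_contra! hcon
        have := hp hcon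
        omega
      have := Finset.card_le_card hsub
      rw [Finset.card_range] at this
      omega
  funext r
  apply eq_of_forall_lt_iff
  intro c
  rw [h1, h2, h]

/-- The parts of the Jordan type can be read off from any Jordan basis with strings of weakly
decreasing lengths. -/
theorem IsJordanType.part_eq {K V : Type*} [Field K] [AddCommGroup V] [Module K V]
    {n : ℕ} {P : n.Partition} {f : V →ₗ[K] V} (hP : IsJordanType P f) {t : ℕ} {p : ℕ → ℕ}
    (hp : Antitone p) (hp0 : p t = 0) (b : Module.Basis (Σ i : Fin t, Fin (p i)) K V)
    (hb : IsJordanBasis b f) : part P = p := by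
  obtain ⟨s, q, b', hq, hb'⟩ := hP
  refine part_eq_of_card_filter_eq P hp hp0 fun c => ?_
  have h1 := IsJordanBasis.card_lt_eq (b := b') hb' hb c
  rw [hq, Multiset.countP_map]
  rw [Finset.card_filter, Finset.card_filter, Fin.sum_univ_eq_sum_range
    (fun r => if c < p r then 1 else 0), ← Finset.card_filter, ← Finset.card_filter] at h1
  exact h1

end CIJordan

namespace CIJordan

open MvPolynomial

variable {K : Type*} [Field K]

/-! ### The action by differentiation in coordinates -/

theorem coeff_partialD_pow (i : Fin 2) (k : ℕ) (H : MvPolynomial (Fin 2) K) (n : Fin 2 →₀ ℕ) :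
    coeff n ((partialD i ^ k) H) =
      ((n i + 1).ascFactorial k : K) * coeff (n + Finsupp.single i k) H := by
  induction k generalizing n H with
  | zero => simp
  | succ k ih =>
    have h : partialD i H = pderiv i H := rfl
    rw [pow_succ, Module.End.mul_apply, ih, h, coeff_pderiv, add_assoc, ← Finsupp.single_add,
      Nat.ascFactorial_succ]
    simp only [Finsupp.add_apply, Finsupp.single_eq_same]
    push_cast
    ring

theorem coeff_diffMonomial (m n : Fin 2 →₀ ℕ) (H : MvPolynomial (Fin 2) K) :
    coeff n (diffMonomial m H) =
      ((n 0 + 1).ascFactorial (m 0) * (n 1 + 1).ascFactorial (m 1) : K) * coeff (n + m) H := by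
  rw [diffMonomial, Module.End.mul_apply, coeff_partialD_pow, coeff_partialD_pow, mul_assoc]
  congr 2
  · simp
  · congr 1
    ext i
    fin_cases i <;> simp

theorem coeff_zero_diffMonomial (m : Fin 2 →₀ ℕ) (H : MvPolynomial (Fin 2) K) :
    coeff 0 (diffMonomial m H) = ((m 0).factorial * (m 1).factorial : K) * coeff m H := by
  rw [coeff_diffMonomial]
  simp [Nat.one_ascFactorial]

theorem diffAct_eq_sum (f H : MvPolynomial (Fin 2) K) :
    diffAct f H = ∑ m ∈ f.support, coeff m f • diffMonomial m H := by
  conv_lhs => rw [f.as_sum]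
  rw [map_sum, LinearMap.sum_apply]
  simp [diffAct_monomial]

theorem coeff_diffAct_eq_zero {f H : MvPolynomial (Fin 2) K} {m j : ℕ} (hf : f.IsHomogeneous m)
    (hH : H.IsHomogeneous j) {n : Fin 2 →₀ ℕ} (hn : n.degree + m ≠ j) :
    coeff n (diffAct f H) = 0 := by
  rw [diffAct_eq_sum, coeff_sum]
  refine Finset.sum_eq_zero fun u hu => ?_
  have hu' : u.degree = m := by
    by_contra h
    exact (mem_support_iff.1 hu) (hf.coeff_eq_zero h)
  rw [coeff_smul, coeff_diffMonomial, hH.coeff_eq_zero, mul_zero, smul_zero]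
  rwa [map_add, hu']

theorem isHomogeneous_diffAct {f H : MvPolynomial (Fin 2) K} {m e j : ℕ} (hf : f.IsHomogeneous m)
    (hH : H.IsHomogeneous j) (he : e + m = j) : (diffAct f H).IsHomogeneous e := by
  intro n hn
  have h1 : n.degree + m = j := by
    by_contra h
    exact hn (coeff_diffAct_eq_zero hf hH h)
  have h2 : n.degree = e := by omega
  rw [← h2, Finsupp.degree_eq_weight_one]
  rfl

theorem mem_Ann_iff {f F : MvPolynomial (Fin 2) K} : f ∈ Ann F ↔ diffAct f F = 0 := Iff.rfl

/-- The contraction pairing of `f` with `F`: the constant term of `f ∘ F`. -/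
noncomputable def contraction (F : MvPolynomial (Fin 2) K) : MvPolynomial (Fin 2) K →ₗ[K] K :=
  lcoeff K 0 ∘ₗ (LinearMap.applyₗ F ∘ₗ diffAct)

theorem contraction_apply (F f : MvPolynomial (Fin 2) K) :
    contraction F f = coeff 0 (diffAct f F) := rfl

theorem contraction_eq_zero_of_mem {F f : MvPolynomial (Fin 2) K} (hf : f ∈ Ann F) :
    contraction F f = 0 := by
  rw [contraction_apply, mem_Ann_iff.1 hf, coeff_zero]

theorem mem_Ann_of_lt {F f : MvPolynomial (Fin 2) K} {m j : ℕ} (hf : f.IsHomogeneous m)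
    (hF : F.IsHomogeneous j) (h : j < m) : f ∈ Ann F := by
  rw [mem_Ann_iff]
  ext n
  rw [coeff_diffAct_eq_zero hf hF (by omega), coeff_zero]

theorem contraction_eq_zero_of_ne {F f : MvPolynomial (Fin 2) K} {m j : ℕ} (hf : f.IsHomogeneous m)
    (hF : F.IsHomogeneous j) (h : m ≠ j) : contraction F f = 0 :=
  coeff_diffAct_eq_zero hf hF (by simpa using h)

/-- Pairing with monomials of degree `e` recovers the coefficients of `f ∘ F` up to products of
factorials, which are nonzero in characteristic zero. -/
theorem mem_Ann_iff_contraction [CharZero K] {F f : MvPolynomial (Fin 2) K} {m e j : ℕ}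
    (hf : f.IsHomogeneous m) (hF : F.IsHomogeneous j) (he : m + e = j) :
    f ∈ Ann F ↔ ∀ g : MvPolynomial (Fin 2) K, g.IsHomogeneous e → contraction F (f * g) = 0 := by
  constructor
  · intro h g _
    exact contraction_eq_zero_of_mem (Ideal.mul_mem_right _ _ h)
  · intro h
    rw [mem_Ann_iff]
    ext n
    rw [coeff_zero]
    by_cases hn : n.degree = e
    · have h1 := h (monomial n 1) (isHomogeneous_monomial 1 hn)
      rw [contraction_apply, mul_comm, diffAct_mul, Module.End.mul_apply, diffAct_monomial,
        one_smul, coeff_zero_diffMonomial] at h1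
      refine (mul_eq_zero.1 h1).resolve_left ?_
      exact mul_ne_zero (by exact_mod_cast Nat.factorial_ne_zero _)
        (by exact_mod_cast Nat.factorial_ne_zero _)
    · exact coeff_diffAct_eq_zero hf hF (by omega)

theorem isHomogeneous_linearForm (p : Fin 2 → K) : (linearForm p).IsHomogeneous 1 :=
  ((isHomogeneous_C_mul_X _ _).add (isHomogeneous_C_mul_X _ _))

theorem diffAct_linearForm (p : Fin 2 → K) (H : MvPolynomial (Fin 2) K) :
    diffAct (linearForm p) H = p 0 • pderiv 0 H + p 1 • pderiv 1 H := by
  have h : ∀ i : Fin 2, diffAct (X i : MvPolynomial (Fin 2) K) H = pderiv i H := by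
    intro i
    rw [X, diffAct_monomial, one_smul]
    fin_cases i <;> simp [diffMonomial, partialD]
  rw [linearForm, map_add, LinearMap.add_apply, C_mul', C_mul', map_smul, map_smul,
    LinearMap.smul_apply, LinearMap.smul_apply, h, h]

/-- The `e`-th power of a linear form evaluates a form of degree `e` at its coefficient vector, up to
the factor `e!`. -/
theorem contraction_linearForm_pow (p : Fin 2 → K) {e : ℕ} {H : MvPolynomial (Fin 2) K}
    (hH : H.IsHomogeneous e) :
    contraction H (linearForm p ^ e) = (e.factorial : K) * eval p H := by
  induction e generalizing H with
  | zero =>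
    rw [← totalDegree_zero_iff_isHomogeneous, totalDegree_eq_zero_iff_eq_C] at hH
    rw [hH, pow_zero, contraction_apply, ← C_1, C_apply, diffAct_monomial]
    simp [diffMonomial]
  | succ e ih =>
    have h1 : (diffAct (linearForm p) H).IsHomogeneous e :=
      isHomogeneous_diffAct (isHomogeneous_linearForm p) hH rfl
    have h2 := ih h1
    -- Euler's identity at `p` supplies the factor `e + 1`.
    have h3 := congrArg (eval p) hH.sum_X_mul_pderiv
    rw [Fin.sum_univ_two] at h3
    simp only [map_add, map_mul, eval_X, nsmul_eq_mul, map_natCast] at h3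
    rw [contraction_apply, pow_succ, diffAct_mul, Module.End.mul_apply, ← contraction_apply, h2,
      diffAct_linearForm, Nat.factorial_succ]
    simp only [map_add, smul_eval, h3]
    push_cast
    ring

/-! ### Binary forms as univariate polynomials -/

section Homogenization

variable (p q : Fin 2 → K)

/-- The substitution of the linear forms with coefficient vectors `q`, `p` for the two variables. -/
noncomputable def substForms : MvPolynomial (Fin 2) K →ₐ[K] MvPolynomial (Fin 2) K :=
  aeval ![linearForm q, linearForm p]

/-- The form `∑ gᵢ y ^ i ℓ ^ (m - i)` of degree `m`, where `ℓ` and `y` are the linear forms with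
coefficient vectors `p` and `q`. -/
noncomputable def homForm (m : ℕ) : Polynomial K →ₗ[K] MvPolynomial (Fin 2) K :=
  (substForms p q).toLinearMap ∘ₗ Polynomial.homogenizeLM m

theorem homForm_apply (m : ℕ) (g : Polynomial K) :
    homForm p q m g = substForms p q (g.homogenize m) := rfl

theorem isHomogeneous_substForms {f : MvPolynomial (Fin 2) K} {m : ℕ} (hf : f.IsHomogeneous m) :
    (substForms p q f).IsHomogeneous m := by
  have h := hf.aeval (![linearForm q, linearForm p]) (n := 1) (fun i => by
    fin_cases i
    · exact isHomogeneous_linearForm q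
    · exact isHomogeneous_linearForm p)
  rwa [one_mul] at h

theorem isHomogeneous_homForm (m : ℕ) (g : Polynomial K) : (homForm p q m g).IsHomogeneous m :=
  isHomogeneous_substForms p q (Polynomial.isHomogeneous_homogenize g)

theorem homForm_mul {g h : Polynomial K} {m n : ℕ} (hg : g.natDegree ≤ m) (hh : h.natDegree ≤ n) :
    homForm p q m g * homForm p q n h = homForm p q (m + n) (g * h) := by
  rw [homForm_apply, homForm_apply, homForm_apply, Polynomial.homogenize_mul g h hg hh, map_mul]

/-- Since `ℓ` is the homogenizing variable, multiplying by it changes only the degree and not `g`.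
-/
theorem linearForm_pow_mul_homForm {g : Polynomial K} {m : ℕ} (hg : g.natDegree ≤ m) (c : ℕ) :
    linearForm p ^ c * homForm p q m g = homForm p q (m + c) g := by
  have h : linearForm p ^ c = homForm p q c 1 := by
    rw [homForm_apply, Polynomial.homogenize_one, map_pow, substForms, aeval_X]
    rfl
  rw [h, mul_comm, homForm_mul p q hg (by simp), mul_one]

variable {p q}

theorem substForms_leftInverse (hpq : p 0 * q 1 - p 1 * q 0 = 1) (f : MvPolynomial (Fin 2) K) :
    substForms ![p 0, -q 0] ![-p 1, q 1] (substForms p q f) = f := by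
  have h : ((substForms ![p 0, -q 0] ![-p 1, q 1]).comp (substForms p q)) = AlgHom.id K _ := by
    have hC : (C (p 0) * C (q 1) - C (p 1) * C (q 0) : MvPolynomial (Fin 2) K) = 1 := by
      rw [← C_mul, ← C_mul, ← C_sub, hpq, C_1]
    refine MvPolynomial.algHom_ext fun i => ?_
    fin_cases i
    · simp [substForms, linearForm, algHom_C]
      linear_combination hC * X 0
    · simp [substForms, linearForm, algHom_C]
      linear_combination hC * X 1
  exact DFunLike.congr_fun h f

theorem substForms_rightInverse (hpq : p 0 * q 1 - p 1 * q 0 = 1) (f : MvPolynomial (Fin 2) K) :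
    substForms p q (substForms ![p 0, -q 0] ![-p 1, q 1] f) = f := by
  have h := substForms_leftInverse (p := ![p 0, -q 0]) (q := ![-p 1, q 1])
    (by simp; linear_combination hpq) f
  have hp : ![(![p 0, -q 0] : Fin 2 → K) 0, -(![-p 1, q 1] : Fin 2 → K) 0] = p := by
    ext i
    fin_cases i <;> simp
  have hq : ![-(![p 0, -q 0] : Fin 2 → K) 1, (![-p 1, q 1] : Fin 2 → K) 1] = q := by
    ext i
    fin_cases i <;> simp
  rwa [hp, hq] at h

theorem exists_homForm_eq (hpq : p 0 * q 1 - p 1 * q 0 = 1) {f : MvPolynomial (Fin 2) K} {m : ℕ}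
    (hf : f.IsHomogeneous m) : ∃ g : Polynomial K, g.natDegree ≤ m ∧ homForm p q m g = f := by
  have h1 := isHomogeneous_substForms ![p 0, -q 0] ![-p 1, q 1] hf
  refine ⟨aeval ![Polynomial.X, 1] (substForms ![p 0, -q 0] ![-p 1, q 1] f), ?_, ?_⟩
  · have := aeval_natDegree_le _ h1.totalDegree_le (![Polynomial.X, 1])
      (n := 1) (fun i => by fin_cases i <;> simp)
    rwa [mul_one] at this
  · rw [homForm_apply, Polynomial.homogenize_eq_of_isHomogeneous h1 rfl,
      substForms_rightInverse hpq]

theorem mem_degreeLT_succ_iff {g : Polynomial K} {m : ℕ} :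
    g ∈ Polynomial.degreeLT K (m + 1) ↔ g.natDegree ≤ m := by
  rw [Polynomial.mem_degreeLT, Polynomial.degree_lt_iff_coeff_zero,
    Polynomial.natDegree_le_iff_coeff_eq_zero]
  rfl

variable (p q)

/-- The functional on univariate polynomials given by homogenization to degree `j` and contraction
with `F`. -/
noncomputable def homFunctional (F : MvPolynomial (Fin 2) K) (j : ℕ) : Polynomial K →ₗ[K] K :=
  contraction F ∘ₗ homForm p q j

variable {p q}

/-- This is Macaulay duality after dehomogenization: the test forms of degree `j - m` are the
polynomials of degree `< j + 1 - m`. -/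
theorem homForm_mem_Ann_iff [CharZero K] (hpq : p 0 * q 1 - p 1 * q 0 = 1)
    {F : MvPolynomial (Fin 2) K} {j : ℕ} (hF : F.IsHomogeneous j) {g : Polynomial K} {m : ℕ}
    (hg : g.natDegree ≤ m) :
    homForm p q m g ∈ Ann F ↔ IsOrth (homFunctional p q F j) (j + 1 - m) g := by
  rcases lt_or_ge j m with hm | hm
  · rw [show j + 1 - m = 0 by omega]
    exact ⟨fun _ => IsOrth.zero g, fun _ => mem_Ann_of_lt (isHomogeneous_homForm p q m g) hF hm⟩
  · obtain ⟨e, rfl⟩ := Nat.exists_eq_add_of_le hm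
    rw [mem_Ann_iff_contraction (isHomogeneous_homForm p q m g) hF rfl,
      show m + e + 1 - m = e + 1 by omega]
    constructor
    · intro h u hu
      rw [mem_degreeLT_succ_iff] at hu
      have := h _ (isHomogeneous_homForm p q e u)
      rwa [homForm_mul p q hg hu] at this
    · intro h u hu
      obtain ⟨v, hv, rfl⟩ := exists_homForm_eq hpq hu
      rw [homForm_mul p q hg hv]
      exact h v (mem_degreeLT_succ_iff.2 hv)

/-- Evaluation at `p` is application of `ℓ ^ (j - 2 * i)` up to a factorial, and this power
disappears on dehomogenization. Hessian entries at `p` are thus Gram entries of the functional. -/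
theorem eval_diffAct_homForm_mul {F : MvPolynomial (Fin 2) K} {i j : ℕ} (hF : F.IsHomogeneous j) (hi : 2 * i ≤ j)
    {a b : Polynomial K} (ha : a.natDegree ≤ i) (hb : b.natDegree ≤ i) :
    ((j - 2 * i).factorial : K) * eval p (diffAct (homForm p q i a * homForm p q i b) F) =
      homFunctional p q F j (a * b) := by
  have hab : (a * b).natDegree ≤ i + i := Polynomial.natDegree_mul_le.trans (by omega)
  rw [homForm_mul p q ha hb, ← contraction_linearForm_pow p (isHomogeneous_diffAct
    (isHomogeneous_homForm p q (i + i) (a * b)) hF (e := j - 2 * i) (by omega)), contraction_apply,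
    ← Module.End.mul_apply, ← diffAct_mul, linearForm_pow_mul_homForm p q hab,
    show i + i + (j - 2 * i) = j by omega]
  rfl

end Homogenization

end CIJordan

namespace CIJordan

open MvPolynomial

variable {K : Type*} [Field K] [CharZero K] {p q : Fin 2 → K} {F : MvPolynomial (Fin 2) K} {j : ℕ}

/-! ### The string basis of `K[x, y] / Ann F` for a nonzero linear form -/

theorem sum_mem_Ann_of_sum_mem {ι : Type*} (hF : F.IsHomogeneous j) {s : Finset ι}
    {f : ι → MvPolynomial (Fin 2) K} {deg : ι → ℕ} (hf : ∀ x, (f x).IsHomogeneous (deg x))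
    (h : ∑ x ∈ s, f x ∈ Ann F) (m : ℕ) : ∑ x ∈ s.filter (fun x => deg x = m), f x ∈ Ann F := by
  have hom : (∑ x ∈ s.filter (fun x => deg x = m), f x).IsHomogeneous m :=
    IsHomogeneous.sum _ _ _ fun x hx => by
      rw [← (Finset.mem_filter.1 hx).2]
      exact hf x
  rcases lt_or_ge j m with hm | hm
  · exact mem_Ann_of_lt hom hF hm
  · obtain ⟨e, rfl⟩ := Nat.exists_eq_add_of_le hm
    rw [mem_Ann_iff_contraction hom hF rfl]
    intro g hg
    have h1 := contraction_eq_zero_of_mem (Ideal.mul_mem_right g _ h)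
    rw [Finset.sum_mul, map_sum] at h1 ⊢
    rw [← h1]
    refine Finset.sum_subset (Finset.filter_subset _ _) fun x hx hxm => ?_
    rw [Finset.mem_filter, not_and] at hxm
    refine contraction_eq_zero_of_ne ((hf x).mul hg) hF ?_
    have := hxm hx
    omega

section StringBasis

variable {g : ℕ → Polynomial K}

/-- In a fixed degree the `g r` that occur have distinct degrees. A relation would put a polynomial
`G` of some degree `r` into the annihilator before the string of `g r` has reached its length,
against the minimality of `orthLength`. -/
theorem linearIndependent_strings (hpq : p 0 * q 1 - p 1 * q 0 = 1) (hF : F.IsHomogeneous j)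
    (hg : ∀ r, (g r).Monic) (hgr : ∀ r, (g r).natDegree = r) (t : ℕ) :
    LinearIndependent K
      fun x : Σ r : Fin t, Fin (orthLength (homFunctional p q F j) j r) =>
        Ideal.Quotient.mkₐ K (Ann F) (homForm p q ((x.1 : ℕ) + x.2) (g x.1)) := by
  classical
  rw [Fintype.linearIndependent_iff]
  intro a ha
  by_contra! hne
  obtain ⟨x₁, hx₁⟩ := hne
  have hmem : ∑ x : Σ r : Fin t, Fin (orthLength (homFunctional p q F j) j r),
      a x • homForm p q ((x.1 : ℕ) + x.2) (g x.1) ∈ Ann F := by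
    rw [← Ideal.Quotient.eq_zero_iff_mem, ← Ideal.Quotient.mkₐ_eq_mk K, map_sum]
    simpa only [map_smul] using ha
  have h1 := sum_mem_Ann_of_sum_mem hF (deg := fun x => (x.1 : ℕ) + x.2)
    (fun x => by
      rw [smul_eq_C_mul]
      exact (isHomogeneous_homForm p q _ _).C_mul _) hmem ((x₁.1 : ℕ) + x₁.2)
  generalize hm : (x₁.1 : ℕ) + x₁.2 = m at h1
  have h2 : homForm p q m (∑ x ∈ Finset.univ.filter
      (fun x : Σ r : Fin t, Fin (orthLength (homFunctional p q F j) j r) =>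
        (x.1 : ℕ) + x.2 = m), a x • g x.1) ∈ Ann F := by
    rw [map_sum]
    convert h1 using 1
    refine Finset.sum_congr rfl fun x hx => ?_
    rw [map_smul, (Finset.mem_filter.1 hx).2]
  set S := Finset.univ.filter
      (fun x : Σ r : Fin t, Fin (orthLength (homFunctional p q F j) j r) =>
        (x.1 : ℕ) + x.2 = m) with hS
  set G := ∑ x ∈ S, a x • g x.1 with hG
  obtain ⟨x₀, hx₀, hmax⟩ := Finset.exists_max_image (S.filter fun x => a x ≠ 0) (fun x => (x.1 : ℕ))
    ⟨x₁, by simp [hS, hm, hx₁]⟩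
  rw [Finset.mem_filter] at hx₀
  have hx₀m : (x₀.1 : ℕ) + x₀.2 = m := (Finset.mem_filter.1 hx₀.1).2
  have hcoeff : ∀ n, (x₀.1 : ℕ) ≤ n → G.coeff n = if n = x₀.1 then a x₀ else 0 := by
    intro n hn
    rw [hG, Polynomial.finsetSum_coeff, Finset.sum_eq_single_of_mem x₀ hx₀.1]
    · rw [Polynomial.coeff_smul]
      split_ifs with h
      · have := (hg x₀.1).coeff_natDegree
        rw [hgr] at this
        rw [h, this, smul_eq_mul, mul_one]
      · rw [Polynomial.coeff_eq_zero_of_natDegree_lt, smul_zero]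
        rw [hgr]
        omega
    · intro y hy hyx
      by_cases hay : a y = 0
      · rw [hay, zero_smul, Polynomial.coeff_zero]
      · have h3 := hmax y (Finset.mem_filter.2 ⟨hy, hay⟩)
        have h4 : (y.1 : ℕ) ≠ x₀.1 := by
          intro h
          have hym : (y.1 : ℕ) + y.2 = m := (Finset.mem_filter.1 hy).2
          apply hyx
          obtain ⟨y1, y2⟩ := y
          obtain ⟨z1, z2⟩ := x₀
          obtain rfl : y1 = z1 := Fin.ext h
          congr 1
          apply Fin.ext
          simp only at hym hx₀m
          omega
        rw [Polynomial.coeff_smul, Polynomial.coeff_eq_zero_of_natDegree_lt, smul_zero]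
        rw [hgr]
        omega
  have hG0 : G ≠ 0 := by
    intro h0
    have := hcoeff x₀.1 le_rfl
    rw [h0, if_pos rfl] at this
    exact hx₀.2 this.symm
  have hGd : G.natDegree = x₀.1 := by
    apply le_antisymm
    · rw [Polynomial.natDegree_le_iff_coeff_eq_zero]
      intro n hn
      rw [hcoeff n hn.le, if_neg hn.ne']
    · apply Polynomial.le_natDegree_of_ne_zero
      rw [hcoeff _ le_rfl, if_pos rfl]
      exact hx₀.2
  rw [homForm_mem_Ann_iff hpq hF (by omega)] at h2
  have h5 := orthLength_natDegree_le (j := j) (c := x₀.2) hG0 (h2.mono (by omega))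
  rw [hGd] at h5
  have := x₀.2.2
  omega

theorem span_strings_eq_top (hpq : p 0 * q 1 - p 1 * q 0 = 1) (hF : F.IsHomogeneous j)
    (hg : ∀ r, (g r).Monic) (hgr : ∀ r, (g r).natDegree = r)
    (ho : ∀ r, IsOrth (homFunctional p q F j)
      (j + 1 - r - orthLength (homFunctional p q F j) j r) (g r)) :
    ⊤ ≤ Submodule.span K (Set.range
      fun x : Σ r : Fin (j + 1), Fin (orthLength (homFunctional p q F j) j r) =>
        Ideal.Quotient.mkₐ K (Ann F) (homForm p q ((x.1 : ℕ) + x.2) (g x.1))) := by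
  set W := Submodule.span K (Set.range
      fun x : Σ r : Fin (j + 1), Fin (orthLength (homFunctional p q F j) j r) =>
        Ideal.Quotient.mkₐ K (Ann F) (homForm p q ((x.1 : ℕ) + x.2) (g x.1))) with hW
  have key : ∀ m r, r ≤ m + 1 → ∀ u ∈ Polynomial.degreeLT K r,
      Ideal.Quotient.mkₐ K (Ann F) (homForm p q m u) ∈ W := by
    intro m r
    induction r with
    | zero =>
      intro _ u hu
      rw [Polynomial.mem_degreeLT, Nat.cast_zero, Nat.WithBot.lt_zero_iff,
        Polynomial.degree_eq_bot] at hu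
      rw [hu, map_zero, map_zero]
      exact Submodule.zero_mem _
    | succ r ih =>
      intro hr u hu
      have h1 : u - u.coeff r • g r ∈ Polynomial.degreeLT K r := by
        rw [Polynomial.mem_degreeLT, Polynomial.degree_lt_iff_coeff_zero] at *
        intro n hn
        rw [Polynomial.coeff_sub, Polynomial.coeff_smul]
        rcases hn.eq_or_lt with rfl | hn
        · have := (hg r).coeff_natDegree
          rw [hgr] at this
          rw [this, smul_eq_mul, mul_one, sub_self]
        · rw [hu n hn, Polynomial.coeff_eq_zero_of_natDegree_lt (p := g r) (by rw [hgr]; exact hn),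
            smul_zero, sub_zero]
      -- In degree `m` the class of `g r` is either a string element or, once the string has ended,
      -- zero.
      have h2 : Ideal.Quotient.mkₐ K (Ann F) (homForm p q m (g r)) ∈ W := by
        by_cases hc : m - r < orthLength (homFunctional p q F j) j r
        · have hle := orthLength_le_sub (L := homFunctional p q F j) (j := j) r
          refine Submodule.subset_span ⟨⟨⟨r, by omega⟩, ⟨m - r, hc⟩⟩, ?_⟩
          simp only
          rw [Nat.add_sub_cancel' (by omega)]
        · have h3 : homForm p q m (g r) ∈ Ann F := by
            rw [homForm_mem_Ann_iff hpq hF (by rw [hgr]; omega)]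
            exact (ho r).mono (by omega)
          rw [Ideal.Quotient.mkₐ_eq_mk, Ideal.Quotient.eq_zero_iff_mem.2 h3]
          exact Submodule.zero_mem _
      have h4 := W.add_mem (ih (by omega) _ h1) (W.smul_mem (u.coeff r) h2)
      rwa [map_sub, map_sub, map_smul, map_smul, sub_add_cancel] at h4
  rintro x -
  obtain ⟨f, rfl⟩ := Ideal.Quotient.mkₐ_surjective K (Ann F) x
  rw [← sum_homogeneousComponent f, map_sum]
  refine Submodule.sum_mem _ fun m _ => ?_
  obtain ⟨u, hu, hum⟩ := exists_homForm_eq hpq (homogeneousComponent_isHomogeneous m f)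
  rw [← hum]
  exact key m (m + 1) le_rfl u (mem_degreeLT_succ_iff.2 hu)

end StringBasis

theorem part_eq_orthLength (hpq : p 0 * q 1 - p 1 * q 0 = 1) (hF : F.IsHomogeneous j) {n : ℕ}
    {P : n.Partition} (hP : IsJordanType P (mulByLinear (Ann F) p)) :
    part P = orthLength (homFunctional p q F j) j := by
  choose g hg hgr ho using orthLength_spec (homFunctional p q F j) j
  refine hP.part_eq isBalanced_orthLength.antitone (isBalanced_orthLength.eq_zero_of_le le_rfl)
    (Module.Basis.mk (linearIndependent_strings hpq hF hg hgr (j + 1))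
      (span_strings_eq_top hpq hF hg hgr ho)) ?_
  intro i a
  have h1 : mulByLinear (Ann F) p
      (Ideal.Quotient.mkₐ K (Ann F) (homForm p q ((i : ℕ) + a) (g i))) =
      Ideal.Quotient.mkₐ K (Ann F) (homForm p q ((i : ℕ) + (a + 1)) (g i)) := by
    rw [mulByLinear, LinearMap.mulLeft_apply, Ideal.Quotient.mkₐ_eq_mk, ← map_mul, ← pow_one
      (linearForm p), linearForm_pow_mul_homForm p q (by rw [hgr]; omega), add_assoc]
  rw [Module.Basis.mk_apply, h1]
  split_ifs with h
  · rw [Module.Basis.mk_apply]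
  · rw [Ideal.Quotient.mkₐ_eq_mk, Ideal.Quotient.eq_zero_iff_mem,
      homForm_mem_Ann_iff hpq hF (by rw [hgr]; omega)]
    have h2 : orthLength (homFunctional p q F j) j i ≤ a + 1 := not_lt.1 h
    exact (ho i).mono (by omega)

/-! ### Hessians and orthogonality -/

/-- The bound `hpos` keeps nonzero forms of degree `i` out of `Ann F`, so `A_i` is the space of all
polynomials of degree `≤ i`. The Hessian matrix at `p` is, up to a nonzero factor, the Gram matrix
of `L (g h)` there, and a kernel vector is a radical element. -/
theorem hessianNonvanishing_iff (hpq : p 0 * q 1 - p 1 * q 0 = 1) (hF : F.IsHomogeneous j) {i : ℕ}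
    (hi : 2 * i ≤ j) (hpos : ∀ r ≤ i, i - r < orthLength (homFunctional p q F j) j r) :
    HessianNonvanishing F p i ↔
      ∀ g ∈ Polynomial.degreeLT K (i + 1), IsOrth (homFunctional p q F j) (i + 1) g → g = 0 := by
  have hfac : ((j - 2 * i).factorial : K) ≠ 0 := by exact_mod_cast Nat.factorial_ne_zero _
  have hinj : ∀ g : Polynomial K, g.natDegree ≤ i → homForm p q i g ∈ Ann F → g = 0 := by
    intro g hg hmem
    by_contra hg0
    rw [homForm_mem_Ann_iff hpq hF hg] at hmem
    have h1 := orthLength_natDegree_le (j := j) (c := i - g.natDegree) hg0 (hmem.mono (by omega))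
    have h2 := hpos _ hg
    omega
  have hentry : ∀ {r : ℕ} (α : Fin r → MvPolynomial (Fin 2) K),
      eval p (hessianMatrix F α).det = ((hessianMatrix F α).map (eval p)).det := by
    intro r α
    rw [RingHom.map_det]
    rfl
  constructor
  · rintro ⟨r, α, ⟨hα, hli, hspan⟩, hdet⟩ g hg ho
    rw [mem_degreeLT_succ_iff] at hg
    have h1 : Ideal.Quotient.mkₐ K (Ann F) (homForm p q i g) ∈
        Submodule.span K (Set.range fun u => Ideal.Quotient.mkₐ K (Ann F) (α u)) := by
      rw [hspan]
      exact ⟨_, isHomogeneous_homForm p q i g, rfl⟩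
    rw [Submodule.mem_span_range_iff_exists_fun] at h1
    obtain ⟨c, hc⟩ := h1
    have h2 : homForm p q i g - ∑ u, c u • α u ∈ Ann F := by
      rw [← Ideal.Quotient.eq_zero_iff_mem, ← Ideal.Quotient.mkₐ_eq_mk K, map_sub, map_sum, ← hc]
      simp only [map_smul, sub_self]
    have h3 : Matrix.vecMul c ((hessianMatrix F α).map (eval p)) = 0 := by
      funext v
      obtain ⟨a, ha, hav⟩ := exists_homForm_eq hpq (hα v)
      have h4 := eval_diffAct_homForm_mul (p := p) (q := q) hF hi hg ha
      rw [ho a (mem_degreeLT_succ_iff.2 ha), hav] at h4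
      replace h4 := (mul_eq_zero.1 h4).resolve_left hfac
      have h5 := mem_Ann_iff.1 (Ideal.mul_mem_right (α v) _ h2)
      rw [sub_mul, map_sub, LinearMap.sub_apply, sub_eq_zero] at h5
      rw [h5, Finset.sum_mul, map_sum, LinearMap.sum_apply, map_sum] at h4
      simp only [smul_mul_assoc, map_smul, LinearMap.smul_apply, smul_eval] at h4
      exact h4
    rw [hentry] at hdet
    have h6 := Matrix.eq_zero_of_vecMul_eq_zero hdet h3
    rw [h6] at h2
    simp only [Pi.zero_apply, zero_smul, Finset.sum_const_zero, sub_zero] at h2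
    exact hinj g hg h2
  · intro hnd
    have hdeg : ∀ c : Fin (i + 1) → K, (∑ u, c u • (Polynomial.X : Polynomial K) ^ (u : ℕ)) ∈
        Polynomial.degreeLT K (i + 1) := by
      intro c
      refine Submodule.sum_mem _ fun u _ => Submodule.smul_mem _ _ ?_
      rw [Polynomial.mem_degreeLT, Polynomial.degree_X_pow]
      exact_mod_cast u.2
    have hzero : ∀ c : Fin (i + 1) → K,
        (∑ u, c u • (Polynomial.X : Polynomial K) ^ (u : ℕ)) = 0 → c = 0 := by
      intro c hc
      funext v
      have := congrArg (fun f => Polynomial.coeff f v) hc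
      simpa [Polynomial.finsetSum_coeff, Polynomial.coeff_X_pow, Fin.val_inj] using this
    refine ⟨i + 1, fun u => homForm p q i (Polynomial.X ^ (u : ℕ)),
      ⟨fun u => isHomogeneous_homForm p q _ _, ?_, ?_⟩, ?_⟩
    · rw [Fintype.linearIndependent_iff]
      intro c hc u
      refine congrFun (hzero c (hinj _ (mem_degreeLT_succ_iff.1 (hdeg c)) ?_)) u
      rw [← Ideal.Quotient.eq_zero_iff_mem, ← Ideal.Quotient.mkₐ_eq_mk K, map_sum, map_sum, ← hc]
      simp only [map_smul]
    · apply le_antisymm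
      · rw [Submodule.span_le]
        rintro _ ⟨u, rfl⟩
        exact ⟨_, isHomogeneous_homForm p q i _, rfl⟩
      · rintro _ ⟨f, hf, rfl⟩
        obtain ⟨a, ha, rfl⟩ := exists_homForm_eq hpq hf
        rw [Submodule.mem_span_range_iff_exists_fun]
        refine ⟨fun u => a.coeff u, ?_⟩
        have h1 : a = ∑ u : Fin (i + 1), a.coeff u • (Polynomial.X : Polynomial K) ^ (u : ℕ) := by
          conv_lhs => rw [a.as_sum_range' (i + 1) (by omega)]
          rw [← Fin.sum_univ_eq_sum_range (fun u => Polynomial.monomial u (a.coeff u))]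
          simp only [Polynomial.smul_X_eq_monomial]
        conv_rhs => rw [h1]
        rw [map_sum, map_sum]
        simp
    · rw [hentry]
      intro hdet
      obtain ⟨c, hc0, hc⟩ := Matrix.exists_vecMul_eq_zero_iff.2 hdet
      refine hc0 (hzero c (hnd _ (hdeg c) ?_))
      have hX : ∀ e ≤ i, homFunctional p q F j
          ((∑ u, c u • (Polynomial.X : Polynomial K) ^ (u : ℕ)) * Polynomial.X ^ e) = 0 := by
        intro e he
        have h1 := congrFun hc ⟨e, by omega⟩
        rw [← eval_diffAct_homForm_mul hF hi (mem_degreeLT_succ_iff.1 (hdeg c))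
          (by simpa using he), mul_eq_zero]
        right
        rw [map_sum, Finset.sum_mul, map_sum, LinearMap.sum_apply, map_sum]
        simp only [map_smul, smul_mul_assoc, LinearMap.smul_apply, smul_eval]
        exact h1
      have : ∀ e ≤ i + 1, IsOrth (homFunctional p q F j) e
          (∑ u, c u • (Polynomial.X : Polynomial K) ^ (u : ℕ)) := by
        intro e
        induction e with
        | zero => exact fun _ => IsOrth.zero _
        | succ e ih => exact fun he => isOrth_succ_iff.2 ⟨ih (by omega), hX e (by omega)⟩
      exact this _ le_rfl

end CIJordan

namespace CIJordan

open MvPolynomial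

/-! ### Jordan types of complete intersections are balanced -/

section CharFree

variable {K : Type*} [Field K]

theorem IsGradedCompleteIntersection.ne_top {I : Ideal (MvPolynomial (Fin 2) K)}
    (h : IsGradedCompleteIntersection I) : I ≠ ⊤ := by
  obtain ⟨f, g, -, -, -, -, hreg, rfl⟩ := h
  intro htop
  apply hreg.top_ne_smul
  have h1 : Ideal.ofList [f, g] = Ideal.span {f, g} := by
    rw [Ideal.ofList_cons, Ideal.ofList_singleton, Ideal.span_insert]
  rw [h1, htop, smul_eq_mul, Ideal.mul_top]

theorem IsJordanType.finrank_eq {V : Type*} [AddCommGroup V] [Module K V]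
    {n : ℕ} {P : n.Partition} {f : V →ₗ[K] V} (hP : IsJordanType P f) : Module.finrank K V = n := by
  obtain ⟨s, p, b, hp, -⟩ := hP
  rw [Module.finrank_eq_card_basis b, Fintype.card_sigma]
  simp only [Fintype.card_fin]
  rw [← P.parts_sum, hp]
  rfl

theorem IsJordanType.part_eq_of_zero {V : Type*} [AddCommGroup V] [Module K V]
    {n : ℕ} {P : n.Partition} (hP : IsJordanType P (0 : V →ₗ[K] V)) :
    part P = fun r => if r < n then 1 else 0 := by
  obtain ⟨s, p, b, hp, hb⟩ := hP
  have h1 : ∀ m ∈ P.parts, m = 1 := by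
    intro m hm
    have hpos := P.parts_pos hm
    rw [hp, Multiset.mem_map] at hm
    obtain ⟨i, -, rfl⟩ := hm
    by_contra hne
    have h2 := hb i ⟨0, hpos⟩
    rw [LinearMap.zero_apply, dif_pos (show 0 + 1 < p i by omega)] at h2
    exact b.ne_zero _ h2.symm
  have h2 := Multiset.eq_replicate_card.2 h1
  have h3 : P.parts.card = n := by
    have := P.parts_sum
    rw [h2, Multiset.sum_replicate] at this
    simpa using this
  rw [h3] at h2
  refine part_eq_of_card_filter_eq P (t := n) ?_ (by simp) fun c => ?_
  · intro a b hab
    dsimp only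
    split_ifs <;> omega
  · rw [h2]
    rcases Nat.eq_zero_or_pos c with rfl | hc
    · rw [Finset.filter_true_of_mem (fun x hx => by simp [Finset.mem_range.1 hx]), Multiset.countP_eq_card.2 (by
        intro a ha
        rw [Multiset.eq_of_mem_replicate ha]
        exact one_pos)]
      simp
    · rw [Finset.filter_false_of_mem, Multiset.countP_eq_zero.2]
      · simp
      · intro a ha
        rw [Multiset.eq_of_mem_replicate ha]
        omega
      · intro r _
        split_ifs <;> omega

theorem isBalanced_indicator {n : ℕ} : IsBalanced (fun r => if r < n then 1 else 0) (n - 1) where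
  antitone := by
    intro a b hab
    dsimp only
    split_ifs <;> omega
  partner := by
    intro r hr
    have hr' : r < n := by
      by_contra h
      simp [h] at hr
    refine ⟨n - 1 - r, ?_, ?_⟩
    · rw [if_pos hr']
      omega
    · rw [if_pos hr', if_pos (by omega)]

theorem not_hessianNonvanishing_zero {F : MvPolynomial (Fin 2) K} {j : ℕ} (hF : F.IsHomogeneous j) (hj : 0 < j)
    (hI : Ann F ≠ ⊤) : ¬ HessianNonvanishing F 0 0 := by
  rintro ⟨r, α, ⟨hα, -, hspan⟩, hdet⟩
  rcases Nat.eq_zero_or_pos r with rfl | hr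
  · have h1 : Ideal.Quotient.mkₐ K (Ann F) 1 ∈
        Submodule.span K (Set.range fun u => Ideal.Quotient.mkₐ K (Ann F) (α u)) := by
      rw [hspan]
      exact ⟨1, isHomogeneous_one _ _, rfl⟩
    rw [Set.range_eq_empty, Submodule.span_empty, Submodule.mem_bot, Ideal.Quotient.mkₐ_eq_mk,
      Ideal.Quotient.eq_zero_iff_mem] at h1
    exact hI ((Ideal.eq_top_iff_one _).2 h1)
  · apply hdet
    rw [RingHom.map_det]
    have : NeZero r := ⟨hr.ne'⟩
    apply Matrix.det_eq_zero_of_row_eq_zero (0 : Fin r)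
    intro v
    have h1 : (diffAct (α 0 * α v) F).IsHomogeneous j :=
      isHomogeneous_diffAct ((hα 0).mul (hα v)) hF rfl
    change eval 0 (diffAct (α 0 * α v) F) = 0
    rw [eval_zero, constantCoeff_eq]
    exact h1.coeff_eq_zero (by simpa using hj.ne)

end CharFree

/-! ### Closed segments and Hessians, including the zero linear form -/

variable {K : Type*} [Field K] [CharZero K] {F : MvPolynomial (Fin 2) K} {p : Fin 2 → K}

/-- If `F` has positive degree, then `K[x, y] / Ann F` is not one-dimensional. -/
theorem finrank_ne_one {j : ℕ} (hF : F.IsHomogeneous j) (hj : 0 < j) (hI : Ann F ≠ ⊤) :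
    Module.finrank K (MvPolynomial (Fin 2) K ⧸ Ann F) ≠ 1 := by
  intro hone
  have : Nontrivial (MvPolynomial (Fin 2) K ⧸ Ann F) := Ideal.Quotient.nontrivial_iff.2 hI
  have hspan := (finrank_eq_one_iff_of_nonzero' (1 : MvPolynomial (Fin 2) K ⧸ Ann F)
    one_ne_zero).1 hone
  apply hI
  rw [Ideal.eq_top_iff_one, mem_Ann_iff_contraction (isHomogeneous_one _ _) hF (zero_add j)]
  intro g hg
  rw [one_mul]
  apply contraction_eq_zero_of_mem
  obtain ⟨c, hc⟩ := hspan (Ideal.Quotient.mk (Ann F) g)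
  -- If `A` were `K`, the class of `g` would be a scalar `c` with `c ^ 2 = 0` for degree reasons.
  -- Then `F` would pair to zero with every form of degree `j`.
  have h1 : Ideal.Quotient.mk (Ann F) (g * g) = 0 :=
    Ideal.Quotient.eq_zero_iff_mem.2 (mem_Ann_of_lt (hg.mul hg) hF (by omega))
  rw [map_mul, ← hc, smul_mul_smul_comm, one_mul, smul_eq_zero, mul_self_eq_zero] at h1
  have hc0 := h1.resolve_right one_ne_zero
  rw [← Ideal.Quotient.eq_zero_iff_mem, ← hc, hc0, zero_smul]

theorem exists_isBalanced_of_ne_zero {d k n : ℕ} (hd : 1 ≤ d) (hk : 1 ≤ k) {P : n.Partition}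
    (hPT : ∀ i, diagonalLength P i = ciSequence d k i) {j : ℕ} (hF : F.IsHomogeneous j) (hp : p ≠ 0)
    (hP : IsJordanType P (mulByLinear (Ann F) p)) :
    IsBalanced (part P) j ∧
      ∀ i < d, HessianNonvanishing F p i ↔ IsClosedAt (part P) j (i + 1) := by
  obtain ⟨q, hpq⟩ : ∃ q : Fin 2 → K, p 0 * q 1 - p 1 * q 0 = 1 := by
    by_cases h0 : p 0 = 0
    · have h1 : p 1 ≠ 0 := by
        intro h1
        apply hp
        ext i
        fin_cases i <;> assumption
      exact ⟨![-(p 1)⁻¹, 0], by simp [h1]⟩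
    · exact ⟨![0, (p 0)⁻¹], by simp [h0]⟩
  have hpart := part_eq_orthLength hpq hF hP
  replace hPT : ∀ i, diagonalCount (part P) i = ciSequence d k i := hPT
  rw [hpart] at hPT ⊢
  have hbal : IsBalanced (orthLength (homFunctional p q F j) j) j := isBalanced_orthLength
  have hj := hbal.socleDegree_eq hd hk hPT
  refine ⟨hbal, fun i hi => ?_⟩
  have hpos : ∀ r ≤ i, i - r < orthLength (homFunctional p q F j) j r := by
    intro r hr
    have := IsBalanced.pos_of_lt hd hk hPT (show r < d by omega)
    omega
  rw [hessianNonvanishing_iff hpq hF (by omega) hpos, isClosedAt_orthLength_iff (by omega)]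
  intro r hr
  have := hpos r (by omega)
  omega

/-- The degree `j` is left existential because for the zero linear form it need not be taken as the
degree of `F`: there the reflection degree comes from the all-ones partition. -/
theorem exists_isBalanced {d k n : ℕ} (hd : 1 ≤ d) (hk : 1 ≤ k) {P : n.Partition}
    (hPT : ∀ i, diagonalLength P i = ciSequence d k i) (hP : IsCIJordanTypeOf P F p) :
    ∃ j, IsBalanced (part P) j ∧
      ∀ i < d, HessianNonvanishing F p i ↔ IsClosedAt (part P) j (i + 1) := by
  obtain ⟨j, hF⟩ := hP.homogeneous
  have hI := hP.completeIntersection.ne_top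
  have hJ := hP.jordanType
  by_cases hp : p = 0
  swap
  · exact ⟨j, exists_isBalanced_of_ne_zero hd hk hPT hF hp hJ⟩
  subst hp
  rcases Nat.eq_zero_or_pos j with rfl | hj
  · have hl : ∀ p : Fin 2 → K, mulByLinear (Ann F) p = 0 := by
      intro p
      rw [mulByLinear, Ideal.Quotient.eq_zero_iff_mem.2
        (mem_Ann_of_lt (isHomogeneous_linearForm p) hF one_pos), LinearMap.mulLeft_zero_eq_zero]
    -- For constant `F` every linear form acts as zero and the Hessians are constants, so `0` may be
    -- replaced by the nonzero vector `1`.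
    rw [hl, ← hl 1] at hJ
    have h1 := exists_isBalanced_of_ne_zero hd hk hPT hF one_ne_zero hJ
    refine ⟨0, h1.1, fun i hi => ?_⟩
    rw [← h1.2 i hi]
    have heval : ∀ {r : ℕ} (α : Fin r → MvPolynomial (Fin 2) K), (∀ u, (α u).IsHomogeneous i) →
        eval 0 (hessianMatrix F α).det = eval 1 (hessianMatrix F α).det := by
      intro r α hα
      rw [RingHom.map_det, RingHom.map_det]
      congr 1
      ext u v
      have h2 : (diffAct (α u * α v) F).IsHomogeneous 0 := by
        intro m hm
        by_contra hne
        apply hm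
        apply coeff_diffAct_eq_zero ((hα u).mul (hα v)) hF
        rw [Finsupp.degree_eq_weight_one]
        change Finsupp.weight 1 m + _ ≠ 0
        omega
      rw [← totalDegree_zero_iff_isHomogeneous, totalDegree_eq_zero_iff_eq_C] at h2
      change eval 0 (diffAct (α u * α v) F) = eval 1 (diffAct (α u * α v) F)
      rw [h2, eval_C, eval_C]
    constructor
    · rintro ⟨r, α, hα, hdet⟩
      exact ⟨r, α, hα, heval α hα.1 ▸ hdet⟩
    · rintro ⟨r, α, hα, hdet⟩
      exact ⟨r, α, hα, (heval α hα.1).symm ▸ hdet⟩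
  · have hl : mulByLinear (Ann F) (0 : Fin 2 → K) = 0 := by
      have : linearForm (0 : Fin 2 → K) = 0 := by simp [linearForm]
      rw [mulByLinear, this, map_zero, LinearMap.mulLeft_zero_eq_zero]
    rw [hl] at hJ
    have hpart := hJ.part_eq_of_zero
    replace hPT : ∀ i, diagonalCount (part P) i = ciSequence d k i := hPT
    have hpos := IsBalanced.pos_of_lt hd hk hPT (show 0 < d by omega)
    have hn : n ≠ 1 := by
      rw [← hJ.finrank_eq]
      exact finrank_ne_one hF hj hI
    rw [hpart] at hpos ⊢
    -- All parts are `1`, which forces `d = 1`. Only `i = 0` remains: the Hessian is a nonzero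
    -- constant multiple of `F`, or another determinant vanishing at the origin, and row `0` is its
    -- own mirror image only if `n = 1`.
    refine ⟨n - 1, isBalanced_indicator, fun i hi => ?_⟩
    have hd1 : d = 1 ∧ 0 < n := by
      dsimp only at hpos
      split_ifs at hpos <;> omega
    obtain rfl : i = 0 := by omega
    refine iff_of_false (not_hessianNonvanishing_zero hF hj hI) fun hc => ?_
    obtain ⟨-, s, hs, hrs⟩ := hc 0 one_pos
    simp only [if_pos hd1.2] at hrs
    omega

end CIJordan

theorem theorem3p12 {K : Type*} [Field K] [CharZero K] (d k : ℕ) (hd : 1 ≤ d) (hk : 1 ≤ k)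
    {n : ℕ} (P Q : n.Partition)
    (hPT : ∀ i, CIJordan.diagonalLength P i = CIJordan.ciSequence d k i)
    (hQT : ∀ i, CIJordan.diagonalLength Q i = CIJordan.ciSequence d k i)
    (F G : MvPolynomial (Fin 2) K) (l l' : Fin 2 → K)
    (hP : CIJordan.IsCIJordanTypeOf P F l) (hQ : CIJordan.IsCIJordanTypeOf Q G l') :
    CIJordan.DominanceLE Q P ↔
      CIJordan.nonvanishingHessians d G l' ⊆ CIJordan.nonvanishingHessians d F l := by
  obtain ⟨j, hbP, hcP⟩ := CIJordan.exists_isBalanced hd hk hPT hP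
  obtain ⟨j', hbQ, hcQ⟩ := CIJordan.exists_isBalanced hd hk hQT hQ
  have hj := hbP.socleDegree_eq hd hk hPT
  have hj' := hbQ.socleDegree_eq hd hk hQT
  -- Both reflection degrees equal `2 * d + k - 3`, so the two partitions obey the same bound on
  -- partial sums.
  obtain rfl : j' = j := by omega
  refine (hbP.dominance_iff hbQ hd hk hPT hQT).trans ⟨fun h i hi => ?_, fun h i hi hc => ?_⟩
  · exact ⟨hi.1, (hcP i hi.1).2 (h i hi.1 ((hcQ i hi.1).1 hi.2))⟩
  · exact (hcP i hi).1 (h ⟨hi, (hcQ i hi).2 hc⟩).2
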